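/- Let $R$ be a commutative Artinian ring and let $A$ be a basic Artin $R$-algebra (an $R$-algebra that is finitely generated as an $R$-module), with a complete set $e_1,\dots,e_n$ of primitive orthogonal idempotents, ordered by their indices; basic means that the left modules $P(i)=Ae_i$ are pairwise non-isomorphic. Let $E(i)$ be the simple top of $P(i)$, let the standard module $\Delta(i)$ be the largest factor module of $P(i)$ with no composition factor $E(j)$, $j>i$, and let the costandard module $\nabla(i)$ be the largest submodule of the injective envelope of $E(i)$ with no composition factor $E(j)$, $j>i$. For a class $\Theta$ of modules, let $\mathcal F(\Theta)$ be the class of modules having a finite filtration all of whose factors are isomorphic to modules in $\Theta$. Suppose that $(A,\le)$ is quasi-hereditary, that is, ${}_AA\in\mathcal F(\Delta)$ and $\mathrm{End}_A(\Delta(i))$ is a division ring for every $i$. Let $T$ be a characteristic module of $A$, that is, a finitely generated left $A$-module for which $\mathrm{add}(T)$, the class of direct summands of finite direct sums of copies of $T$, equals $\mathcal F(\Delta)\cap\mathcal F(\nabla)$ in the category of finitely generated left $A$-modules. Then $$\max\{\operatorname{proj.dim} T,\ \operatorname{inj.dim} T\}\ \le\ \operatorname{gl.dim} A\ \le\ \operatorname{proj.dim}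 T+\operatorname{inj.dim} T,$$ where $\operatorname{gl.dim} A$ is the supremum of the projective dimensions of the finitely generated left $A$-modules. (For $A=0$ all these dimensions are $-\infty$.) -/

import Mathlib

open CategoryTheory

universe u

namespace QuasiHereditary

/-! ### Generalities on modules over a ring -/

section General

variable {A : Type u} [Ring A]

/-- `S` (meant to be simple) is a composition factor of `M` (meant to be of finite length):
it is isomorphic to a subquotient `N / N'` with `N' ⊆ N ⊆ M`. -/
def IsCompositionFactor (S M : Type u) [AddCommGroup S] [Module A S] [AddCommGroup M]
    [Module A M] : Prop :=
  ∃ (N : Submodule A M) (N' : Submodule A N), Nonempty ((N ⧸ N') ≃ₗ[A] S)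

/-- A primitive idempotent: a nonzero idempotent that is not the sum of two nonzero
orthogonal idempotents. -/
def IsPrimitiveIdempotent (e : A) : Prop :=
  IsIdempotentElem e ∧ e ≠ 0 ∧
    ∀ f g : A, IsIdempotentElem f → IsIdempotentElem g → f * g = 0 → g * f = 0 →
      f + g = e → f = 0 ∨ g = 0

/-- A Schur module: its endomorphism ring is a division ring. -/
def IsSchurModule (M : Type u) [AddCommGroup M] [Module A M] : Prop :=
  Nontrivial (Module.End A M) ∧ ∀ f : Module.End A M, f ≠ 0 → IsUnit f

/-- `ι : E → I` is an injective envelope of `E`: an essential monomorphism into an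
injective module. -/
structure IsInjectiveEnvelope {E I : Type u} [AddCommGroup E] [Module A E]
    [AddCommGroup I] [Module A I] (ι : E →ₗ[A] I) : Prop where
  isInjective : Module.Injective A I
  mono : Function.Injective ι
  essential : ∀ N : Submodule A I, N ⊓ LinearMap.range ι = ⊥ → N = ⊥

/-- The class `F(Θ)`: the modules `M` with a filtration `0 = F t ⊆ ⋯ ⊆ F 1 ⊆ F 0 = M` all of
whose factors `F i / F (i + 1)` belong to `Θ`. -/
def Filtered (Θ : ObjectProperty (ModuleCat.{u} A)) : ObjectProperty (ModuleCat.{u} A) :=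
  fun M => ∃ (t : ℕ) (F : ℕ → Submodule A M), F 0 = ⊤ ∧ F t = ⊥ ∧
    ∀ i < t, F (i + 1) ≤ F i ∧ Θ (ModuleCat.of A (F i ⧸ (F (i + 1)).submoduleOf (F i)))

/-- The class `add T`: direct summands of finite direct sums of copies of `T`. -/
def addClosure (T : ModuleCat.{u} A) : ObjectProperty (ModuleCat.{u} A) :=
  fun X => ∃ (m : ℕ) (s : X →ₗ[A] (Fin m → T)) (r : (Fin m → T) →ₗ[A] X),
    r ∘ₗ s = LinearMap.id

variable (A) in
/-- The global dimension: the supremum of the projective dimensions of the finitely generated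
left modules. (As for `projectiveDimension`, the value `⊥` occurs only for the zero ring.) -/
noncomputable def globalDimension : WithBot ℕ∞ :=
  ⨆ (M : ModuleCat.{u} A) (_ : Module.Finite A M), projectiveDimension M

end General

/-! ### Standard and costandard modules

Here `e 0, …, e (n - 1)` is a complete set of primitive orthogonal idempotents, ordered by the
natural ordering of the indices. -/

section Standard

variable {A : Type u} [Ring A] {n : ℕ} (e : Fin n → A)

/-- The left module `P(i) = A eᵢ`. -/
abbrev P (i : Fin n) : Submodule A A := Submodule.span A {e i}

/-- The simple module `E(i)`, the top of `P(i)`. -/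
abbrev E (i : Fin n) : Type u := P e i ⧸ Module.jacobson A (P e i)

/-- `M` has no composition factor `E(j)` with `j > i`. -/
def NoFactorAbove (i : Fin n) (M : Type u) [AddCommGroup M] [Module A M] : Prop :=
  ∀ j, i < j → ¬ IsCompositionFactor (A := A) (E e j) M

/-- The smallest submodule `U` of `P(i)` such that `P(i) / U` has no composition factor `E(j)`
with `j > i`. -/
def standardKernel (i : Fin n) : Submodule A (P e i) :=
  sInf {U | NoFactorAbove e i (P e i ⧸ U)}

/-- The standard module `Δ(i)`: the largest factor module of `P(i)` without composition factors
`E(j)`, `j > i`. -/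
abbrev standard (i : Fin n) : Type u := P e i ⧸ standardKernel e i

/-- For a module `I` (meant to be the injective envelope of `E(i)`), the largest submodule
of `I` without composition factors `E(j)`, `j > i`. -/
def costandardIn (i : Fin n) (I : Type u) [AddCommGroup I] [Module A I] : Submodule A I :=
  sSup {V | NoFactorAbove e i V}

/-- The class of the standard modules `Δ(1), …, Δ(n)`, up to isomorphism. -/
def Delta : ObjectProperty (ModuleCat.{u} A) :=
  fun M => ∃ i, Nonempty (M ≃ₗ[A] standard e i)

/-- The class of the costandard modules `∇(1), …, ∇(n)`, up to isomorphism: `∇(i)` is the largest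
submodule without composition factors `E(j)`, `j > i`, of the injective envelope of `E(i)`. -/
def Nabla : ObjectProperty (ModuleCat.{u} A) :=
  fun M => ∃ (i : Fin n) (I : ModuleCat.{u} A) (ι : E e i →ₗ[A] I),
    IsInjectiveEnvelope ι ∧ Nonempty (M ≃ₗ[A] costandardIn e i I)

/-- `(A, ≤)` is a quasi-hereditary algebra: `A` is basic, the `eᵢ` form a complete set of
primitive orthogonal idempotents, `A` as a left module has a filtration by standard modules,
and the standard modules are Schur modules. (That `A` is an Artin algebra is not part of this
predicate.) -/
structure IsQuasiHereditary : Prop where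
  complete : CompleteOrthogonalIdempotents e
  primitive : ∀ i, IsPrimitiveIdempotent (e i)
  basic : ∀ i j, Nonempty (P e i ≃ₗ[A] P e j) → i = j
  filtered : Filtered (Delta e) (ModuleCat.of A A)
  schur : ∀ i, IsSchurModule (A := A) (standard e i)

/-- `T` is a characteristic module: a finitely generated module with
`add T = F(Δ) ∩ F(∇)` as classes of finitely generated modules. -/
structure IsCharacteristicModule (T : ModuleCat.{u} A) : Prop where
  finite : Module.Finite A T
  add_iff : ∀ X : ModuleCat.{u} A, Module.Finite A X →
    (addClosure T X ↔ Filtered (Delta e) X ∧ Filtered (Nabla e) X)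

end Standard

end QuasiHereditary

/-!
`Ext¹(Δ(i), ∇(j)) = 0` for all `i`, `j`: `Δ(i)` is projective relative to the modules whose
composition factors `E(l)` have `l ≤ i`, `∇(j)` is injective relative to those with `l ≤ j`, and
`∇(j)` belongs to the former class if `j ≤ i`, `Δ(i)` to the latter if `i ≤ j`. As `A` is
filtered by standard modules, so is the submodule generated by the `e l • A` with `l > i`, which
has the kernel of `P(i) → Δ(i)` as a direct summand; hence `Extᵏ(Δ(i), ∇(j)) = 0` for all `k > 0`
by dimension shifting.

Two constructions carry the proof.
* A finitely generated module `Y` with `Ext¹(Δ(j), Y) = 0` for all `j` is filtered by costandard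
  modules, with those of smaller index further down (`exists_belowPart_exact`,
  `filtered_of_extVanish`).
* Every finitely generated module `N` embeds in such a module `Y` with `Y / N` filtered by standard
  modules (`exists_approximation`), by universal extensions. Here it matters that `A` is an Artin
  algebra: the relevant groups of homomorphisms are finitely generated over the base ring.

For `N = Δ(i)` this gives a module in `F(Δ) ∩ F(∇) = add T` that has `Δ(i)` as a submodule with
quotient filtered by the `Δ(j)`, `j < i`, and, up to multiplicity, `∇(i)` as a quotient with kernel
filtered by the `∇(j)`, `j < i`. By induction on `i`, `proj.dim Δ(i) ≤ t = proj.dim T` and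
`inj.dim ∇(i) ≤ s = inj.dim T`. For arbitrary `N`, iterating the embedding gives a coresolution
of `N` whose `t`-th cosyzygy `Z` has `Ext¹(Δ(j), Z) = Ext^{t+1}(Δ(j), N) = 0`, so that all its terms
can be taken to be filtered by costandard modules and `inj.dim N ≤ s + t`. This bounds the
projective dimensions of finitely generated modules over the Noetherian ring `A`.

The lower bound for `inj.dim T` is Baer's criterion: injective dimension is detected by extensions
of cyclic modules. Throughout, the condition on composition factors is expressed by idempotents:
`E(j)` is a composition factor of `M` if and only if `e j • M ≠ 0` (`isCompositionFactor_iff`).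
-/

open CategoryTheory

namespace QuasiHereditary

/-! ### Primitive idempotents of Artinian rings -/

section Idempotents

variable {A : Type u} [Ring A]

/-- The homomorphism `A a → M`, `x ↦ x • m`. -/
def spanHom (a : A) {M : Type*} [AddCommGroup M] [Module A M] (m : M) :
    Submodule.span A {a} →ₗ[A] M :=
  (LinearMap.toSpanSingleton A M m) ∘ₗ (Submodule.span A {a}).subtype

/-- The generator `a` of the left ideal `A a`. -/
def spanGen (a : A) : Submodule.span A {a} := ⟨a, Submodule.mem_span_singleton_self a⟩

lemma mul_idem_of_mem {a : A} (ha : IsIdempotentElem a) {x : A} (hx : x ∈ Submodule.span A {a}) :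
    x * a = x := by
  obtain ⟨b, rfl⟩ := Submodule.mem_span_singleton.1 hx
  rw [smul_eq_mul, mul_assoc, ha]

lemma eq_smul_spanGen {a : A} (ha : IsIdempotentElem a) (x : Submodule.span A {a}) :
    x = (x : A) • spanGen a :=
  Subtype.ext (mul_idem_of_mem ha x.2).symm

lemma smul_spanGen_self {a : A} (ha : IsIdempotentElem a) : a • spanGen a = spanGen a :=
  Subtype.ext ha

lemma eq_top_of_spanGen_mem {a : A} (ha : IsIdempotentElem a)
    {U : Submodule A (Submodule.span A {a})} (h : spanGen a ∈ U) : U = ⊤ := by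
  refine eq_top_iff.2 fun x _ => ?_
  rw [eq_smul_spanGen ha x]
  exact U.smul_mem _ h

lemma hom_apply_eq {a : A} (ha : IsIdempotentElem a) {M : Type*} [AddCommGroup M] [Module A M]
    (f : Submodule.span A {a} →ₗ[A] M) (x : Submodule.span A {a}) :
    f x = (x : A) • f (spanGen a) := by
  conv_lhs => rw [eq_smul_spanGen ha x]
  rw [map_smul]

lemma spanHom_injOn {a : A} (ha : IsIdempotentElem a) {M : Type*} [AddCommGroup M] [Module A M]
    {f g : Submodule.span A {a} →ₗ[A] M} (h : f (spanGen a) = g (spanGen a)) : f = g := by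
  ext x
  rw [hom_apply_eq ha f, hom_apply_eq ha g, h]

/-- `A a` is indecomposable if the idempotent `a` is primitive: the components of `a` in a direct
decomposition are orthogonal idempotents. -/
lemma IsPrimitiveIdempotent.eq_bot_or_eq_bot {a : A} (ha : IsPrimitiveIdempotent a)
    {U W : Submodule A (Submodule.span A {a})} (h : IsCompl U W) : U = ⊥ ∨ W = ⊥ := by
  have hid := ha.1
  obtain ⟨u, hu, w, hw, huw⟩ := Submodule.mem_sup.1
    (show spanGen a ∈ U ⊔ W from h.sup_eq_top ▸ Submodule.mem_top)
  have key : ∀ (U W : Submodule A (Submodule.span A {a})) (u w : Submodule.span A {a}),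
      Disjoint U W → u ∈ U → w ∈ W → u + w = spanGen a →
      (u : A) * u = u ∧ (u : A) * w = 0 := by
    intro U W u w h hu hw huw
    have h1 : (u : A) • u + (u : A) • w = u := by
      rw [← smul_add, huw, ← eq_smul_spanGen hid]
    have h2 : (u : A) • w = u - (u : A) • u := by
      rw [eq_sub_iff_add_eq, add_comm]; exact h1
    have h3 : (u : A) • w = 0 := by
      refine Submodule.disjoint_def.1 h _ ?_ (W.smul_mem _ hw)
      rw [h2]; exact U.sub_mem hu (U.smul_mem _ hu)
    rw [h3, add_zero] at h1
    exact ⟨congrArg Subtype.val h1, congrArg Subtype.val h3⟩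
  obtain ⟨h1, h2⟩ := key U W u w h.disjoint hu hw huw
  obtain ⟨h3, h4⟩ := key W U w u h.disjoint.symm hw hu (by rw [add_comm]; exact huw)
  rcases ha.2.2 u w h1 h3 h2 h4 (congrArg Subtype.val huw) with h0 | h0
  · left
    have : u = 0 := Subtype.ext h0
    rw [this, zero_add] at huw
    have hW : W = ⊤ := eq_top_of_spanGen_mem hid (huw ▸ hw)
    exact disjoint_top.1 (hW ▸ h.disjoint)
  · right
    have : w = 0 := Subtype.ext h0
    rw [this, add_zero] at huw
    have hU : U = ⊤ := eq_top_of_spanGen_mem hid (huw ▸ hu)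
    exact top_disjoint.1 (hU ▸ h.disjoint)

variable [IsArtinianRing A]

/-- By Fitting's lemma, `A a` has at most one maximal submodule if `a` is primitive: if there
were two of them, `M₁` and `M₂`, some endomorphism of `A a` would have image in `M₂` and induce
the identity on `A a / M₁`, so that it would be neither nilpotent nor bijective. -/
lemma IsPrimitiveIdempotent.eq_of_isCoatom {a : A} (ha : IsPrimitiveIdempotent a)
    {M₁ M₂ : Submodule A (Submodule.span A {a})} (h₁ : IsCoatom M₁) (h₂ : IsCoatom M₂) :
    M₁ = M₂ := by
  by_contra hne
  have hid := ha.1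
  obtain ⟨u, hu, w, hw, huw⟩ := Submodule.mem_sup.1
    (show spanGen a ∈ M₁ ⊔ M₂ from (h₁.sup_eq_top_of_ne h₂ hne) ▸ Submodule.mem_top)
  let f : Module.End A (Submodule.span A {a}) := spanHom a w
  have hf : ∀ x, f x ∈ M₂ := fun x => M₂.smul_mem _ hw
  have hf1 : ∀ x, x - f x ∈ M₁ := by
    intro x
    have : x - f x = (x : A) • u := by
      rw [sub_eq_iff_eq_add]
      change x = (x : A) • u + (x : A) • w
      rw [← smul_add, huw, ← eq_smul_spanGen hid]
    rw [this]; exact M₁.smul_mem _ hu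
  have hfk : ∀ k x, x - (f ^ k) x ∈ M₁ := by
    intro k
    induction k with
    | zero => intro x; simp
    | succ k ih =>
      intro x
      have h := M₁.add_mem (ih x) (hf1 ((f ^ k) x))
      rw [sub_add_sub_cancel] at h
      rwa [pow_succ', Module.End.mul_apply]
  obtain ⟨k, hk⟩ := Filter.eventually_atTop.1 (LinearMap.eventually_isCompl_ker_pow_range_pow f)
  have hk := hk (k + 1) (Nat.le_succ k)
  rcases ha.eq_bot_or_eq_bot hk with h0 | h0
  · have htop : LinearMap.range (f ^ (k + 1)) = ⊤ := by
      have := hk.sup_eq_top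
      rwa [h0, bot_sup_eq] at this
    refine h₂.1 (eq_top_iff.2 ?_)
    rw [← htop]
    rintro _ ⟨x, rfl⟩
    rw [pow_succ', Module.End.mul_apply]
    exact hf _
  · refine h₁.1 (eq_top_iff.2 fun x _ => ?_)
    have hx := hfk (k + 1) x
    have : (f ^ (k + 1)) x = 0 := by
      have : (f ^ (k + 1)) x ∈ LinearMap.range (f ^ (k + 1)) := ⟨x, rfl⟩
      rwa [h0, Submodule.mem_bot] at this
    rwa [this, sub_zero] at hx

lemma IsPrimitiveIdempotent.isCoatom_jacobson {a : A} (ha : IsPrimitiveIdempotent a) :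
    IsCoatom (Module.jacobson A (Submodule.span A {a})) := by
  have hnt : Nontrivial (Submodule A (Submodule.span A {a})) := by
    rw [Submodule.nontrivial_iff]
    refine ⟨spanGen a, 0, fun h => ha.2.1 (congrArg Subtype.val h)⟩
  obtain ⟨M, hM, -⟩ := (eq_top_or_exists_le_coatom
    (⊥ : Submodule A (Submodule.span A {a}))).resolve_left bot_ne_top
  have : Module.jacobson A (Submodule.span A {a}) = M := by
    refine le_antisymm (sInf_le hM) (le_sInf fun M' hM' => (ha.eq_of_isCoatom hM hM').le)
  rwa [this]

lemma IsPrimitiveIdempotent.le_jacobson {a : A} (ha : IsPrimitiveIdempotent a)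
    {U : Submodule A (Submodule.span A {a})} (hU : U ≠ ⊤) :
    U ≤ Module.jacobson A (Submodule.span A {a}) := by
  obtain ⟨M, hM, hUM⟩ := (eq_top_or_exists_le_coatom U).resolve_left hU
  rwa [← ha.eq_of_isCoatom hM ha.isCoatom_jacobson]

end Idempotents

/-! ### Simple modules and composition factors -/

section Simple

variable {A : Type u} [Ring A] {n : ℕ} {e : Fin n → A}

lemma IsQuasiHereditary.idem (hA : IsQuasiHereditary e) (i : Fin n) : IsIdempotentElem (e i) :=
  (hA.primitive i).1

lemma exists_smul_ne_zero_of_isCompositionFactor {j : Fin n} {M S : Type u} [AddCommGroup M]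
    [Module A M] [AddCommGroup S] [Module A S] (h : IsCompositionFactor (A := A) S M)
    (hS : ∃ s : S, e j • s ≠ 0) : ∃ x : M, e j • x ≠ 0 := by
  obtain ⟨N, N', ⟨φ⟩⟩ := h
  obtain ⟨s, hs⟩ := hS
  obtain ⟨y, hy⟩ := Submodule.mkQ_surjective N' (φ.symm s)
  refine ⟨y, fun h0 => hs ?_⟩
  have : e j • y = 0 := Subtype.ext h0
  have h1 : e j • φ.symm s = 0 := by rw [← hy, ← map_smul, this, map_zero]
  rw [← φ.apply_symm_apply s, ← map_smul, h1, map_zero]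

/-- The generator of the simple module `E(j)`. -/
def topGen (e : Fin n → A) (j : Fin n) : E e j := Submodule.Quotient.mk (spanGen (e j))

lemma smul_topGen {j : Fin n} (hj : IsPrimitiveIdempotent (e j)) :
    e j • topGen e j = topGen e j := by
  change Submodule.Quotient.mk (e j • spanGen (e j)) = _
  rw [smul_spanGen_self hj.1]; rfl

variable [IsArtinianRing A]

lemma IsQuasiHereditary.isSimpleModule_E (hA : IsQuasiHereditary e) (i : Fin n) :
    IsSimpleModule A (E e i) :=
  isSimpleModule_iff_isCoatom.2 (hA.primitive i).isCoatom_jacobson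

/-- A module that contains an element `x` with `e j • x ≠ 0` has a subquotient `E(j)`: the
quotient of `A (e j • x)` by the image of the radical of `P(j)`. -/
lemma isCompositionFactor_of_smul_ne_zero {j : Fin n} (hj : IsPrimitiveIdempotent (e j))
    {M : Type u} [AddCommGroup M] [Module A M] {x : M} (hx : e j • x ≠ 0) :
    IsCompositionFactor (A := A) (E e j) M := by
  let f : P e j →ₗ[A] M := spanHom (e j) x
  let J := Module.jacobson A (P e j)
  have hker : LinearMap.ker f ≤ J := by
    refine hj.le_jacobson fun h => hx ?_
    have : spanGen (e j) ∈ LinearMap.ker f := h ▸ Submodule.mem_top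
    exact this
  refine ⟨LinearMap.range f, J.map f.rangeRestrict, ⟨?_⟩⟩
  have hker' : LinearMap.ker f.rangeRestrict ≤ J := by rwa [LinearMap.ker_rangeRestrict]
  have hJ : J = LinearMap.ker ((J.map f.rangeRestrict).mkQ ∘ₗ f.rangeRestrict) := by
    rw [LinearMap.ker_comp, Submodule.ker_mkQ, Submodule.comap_map_eq, sup_eq_left.2 hker']
  refine (LinearEquiv.trans (Submodule.quotEquivOfEq _ _ hJ)
    (LinearMap.quotKerEquivOfSurjective _ ?_)).symm
  exact (Submodule.mkQ_surjective _).comp f.surjective_rangeRestrict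

lemma topGen_ne_zero {j : Fin n} (hj : IsPrimitiveIdempotent (e j)) : topGen e j ≠ 0 := by
  intro h
  exact hj.isCoatom_jacobson.1
    (eq_top_of_spanGen_mem hj.1 ((Submodule.Quotient.mk_eq_zero _).1 h))

lemma isCompositionFactor_iff {j : Fin n} (hj : IsPrimitiveIdempotent (e j))
    {M : Type u} [AddCommGroup M] [Module A M] :
    IsCompositionFactor (A := A) (E e j) M ↔ ∃ x : M, e j • x ≠ 0 :=
  ⟨fun h => exists_smul_ne_zero_of_isCompositionFactor h
    ⟨topGen e j, by rw [smul_topGen hj]; exact topGen_ne_zero hj⟩,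
    fun ⟨_, hx⟩ => isCompositionFactor_of_smul_ne_zero hj hx⟩

/-- As `A` is basic, `e k` kills `E(j)` for `k ≠ j`: otherwise `P(k)` would map onto `E(j)`,
hence onto `P(j)`, and being indecomposable it would be isomorphic to `P(j)`. -/
lemma IsQuasiHereditary.smul_E_eq_zero (hA : IsQuasiHereditary e) {j k : Fin n} (hjk : k ≠ j)
    (x : E e j) : e k • x = 0 := by
  by_contra hx
  apply hjk
  apply hA.basic
  have := hA.isSimpleModule_E j
  obtain ⟨y, rfl⟩ := Submodule.mkQ_surjective _ x
  -- `f : P(k) → P(j)` is surjective because its image is not contained in the radical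
  let f : P e k →ₗ[A] P e j := spanHom (e k) (e k • y)
  have hf : LinearMap.range f = ⊤ := by
    by_contra h
    have h1 := (hA.primitive j).le_jacobson h (x := f (spanGen (e k))) ⟨_, rfl⟩
    apply hx
    rw [← map_smul, Submodule.mkQ_apply, Submodule.Quotient.mk_eq_zero]
    have : f (spanGen (e k)) = e k • y := by
      change e k • e k • y = _
      rw [smul_smul, hA.idem k]
    rwa [this] at h1
  obtain ⟨z, hz⟩ := LinearMap.range_eq_top.1 hf (spanGen (e j))
  let g : P e j →ₗ[A] P e k := spanHom (e j) z
  have hfg : f ∘ₗ g = LinearMap.id := by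
    refine spanHom_injOn (hA.idem j) ?_
    change f (e j • z) = _
    rw [map_smul, hz, smul_spanGen_self (hA.idem j)]; rfl
  have hfg' : ∀ y, f (g y) = y := fun y => LinearMap.congr_fun hfg y
  have hg : LinearMap.range g = ⊤ := by
    by_contra h
    have hJ := hA.primitive k
    have hker : LinearMap.ker f ≠ ⊤ := by
      intro hk
      have hz0 : f z = 0 := (hk ▸ Submodule.mem_top : z ∈ LinearMap.ker f)
      rw [hz] at hz0
      exact (hA.primitive j).2.1 (congrArg Subtype.val hz0)
    refine hJ.isCoatom_jacobson.1 (eq_top_iff.2 fun x _ => ?_)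
    have h1 := hJ.le_jacobson h (x := g (f x)) ⟨_, rfl⟩
    have h2 := hJ.le_jacobson hker (x := x - g (f x)) (by
      rw [LinearMap.mem_ker, map_sub, hfg', sub_self])
    simpa using Submodule.add_mem _ h1 h2
  refine ⟨(LinearEquiv.ofBijective g ⟨fun x y h => ?_, LinearMap.range_eq_top.1 hg⟩).symm⟩
  rw [← hfg' x, h, hfg']

end Simple

/-! ### Modules annihilated by the idempotents of large index -/

section Below

variable {A : Type u} [Ring A] {n : ℕ} (e : Fin n → A)

/-- `M` is annihilated by all `e j` with `k ≤ j`. For the simple modules `E(j)` of a basic algebra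
this says that all composition factors of `M` are of the form `E(j)` with `j < k`. -/
def IsBelow (k : ℕ) (M : Type*) [AddCommGroup M] [Module A M] : Prop :=
  ∀ j : Fin n, k ≤ j → ∀ m : M, e j • m = 0

/-- The largest submodule of `M` annihilated by all `e j` with `k ≤ j`. -/
def belowPart (k : ℕ) (M : Type*) [AddCommGroup M] [Module A M] : Submodule A M where
  carrier := {m | ∀ j : Fin n, k ≤ j → ∀ a : A, e j • a • m = 0}
  add_mem' hx hy j hj a := by rw [smul_add, smul_add, hx j hj, hy j hj, add_zero]
  zero_mem' j hj a := by simp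
  smul_mem' c x hx j hj a := by rw [smul_smul a c]; exact hx j hj _

/-- The submodule of `M` generated by the `e j • m` with `k ≤ j`. -/
def aboveSpan (k : ℕ) (M : Type*) [AddCommGroup M] [Module A M] : Submodule A M :=
  Submodule.span A {x | ∃ j : Fin n, k ≤ j ∧ ∃ m : M, x = e j • m}

variable {e} {k : ℕ} {M N : Type*} [AddCommGroup M] [Module A M] [AddCommGroup N] [Module A N]

lemma IsBelow.of_injective (h : IsBelow e k N) (f : M →ₗ[A] N) (hf : Function.Injective f) :
    IsBelow e k M := fun j hj m => hf (by rw [map_smul, h j hj, map_zero])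

lemma IsBelow.of_surjective (h : IsBelow e k M) (f : M →ₗ[A] N) (hf : Function.Surjective f) :
    IsBelow e k N := fun j hj m => by
  obtain ⟨x, rfl⟩ := hf m
  rw [← map_smul, h j hj, map_zero]

lemma IsBelow.mono (h : IsBelow e k M) {l : ℕ} (hkl : k ≤ l) : IsBelow e l M :=
  fun j hj => h j (hkl.trans hj)

lemma IsBelow.submodule (h : IsBelow e k M) (U : Submodule A M) : IsBelow e k U :=
  h.of_injective U.subtype U.injective_subtype

lemma IsBelow.quotient (h : IsBelow e k M) (U : Submodule A M) : IsBelow e k (M ⧸ U) :=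
  h.of_surjective U.mkQ U.mkQ_surjective

lemma isBelow_submodule_iff {U : Submodule A M} : IsBelow e k U ↔ U ≤ belowPart e k M := by
  refine ⟨fun h x hx j hj a => ?_, fun h j hj m => Subtype.ext ?_⟩
  · exact congrArg Subtype.val (h j hj ⟨a • x, U.smul_mem a hx⟩)
  · simpa using h m.2 j hj 1

lemma isBelow_belowPart : IsBelow e k (belowPart e k M) := isBelow_submodule_iff.2 le_rfl

lemma IsBelow.range_le (h : IsBelow e k M) (f : M →ₗ[A] N) :
    LinearMap.range f ≤ belowPart e k N :=
  isBelow_submodule_iff.1 (h.of_surjective f.rangeRestrict f.surjective_rangeRestrict)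

lemma isBelow_iff_belowPart_eq_top : IsBelow e k M ↔ belowPart e k M = ⊤ := by
  refine ⟨fun h => eq_top_iff.2 fun m _ j hj a => h j hj _, fun h j hj m => ?_⟩
  have : m ∈ belowPart e k M := h ▸ Submodule.mem_top
  simpa using this j hj 1

lemma isBelow_of_le (h : n ≤ k) : IsBelow e k M := fun j hj => absurd j.2 (by lia)

lemma IsBelow.subsingleton (he : CompleteOrthogonalIdempotents e) (h : IsBelow e 0 M) :
    Subsingleton M := by
  refine subsingleton_of_forall_eq 0 fun m => ?_
  rw [← one_smul A m, ← he.complete, Finset.sum_smul]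
  exact Finset.sum_eq_zero fun j _ => h j (Nat.zero_le _) m

/-- Extensions of modules annihilated by the idempotents `e j`, `k ≤ j`, are annihilated
by them. -/
lemma IsBelow.of_exact (he : CompleteOrthogonalIdempotents e) {L : Type*} [AddCommGroup L]
    [Module A L] {f : L →ₗ[A] M} {g : M →ₗ[A] N} (hfg : Function.Exact f g)
    (hL : IsBelow e k L) (hN : IsBelow e k N) : IsBelow e k M := fun j hj m => by
  obtain ⟨x, hx⟩ := (hfg (e j • m)).1 (by rw [map_smul, hN j hj])
  rw [← he.idem j, mul_smul, ← hx, ← map_smul, hL j hj, map_zero]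

lemma belowPart_mono {l : ℕ} (h : k ≤ l) : belowPart e k M ≤ belowPart e l M :=
  fun _ hm j hj => hm j (h.trans hj)

lemma map_mem_belowPart {m : M} (hm : m ∈ belowPart e k M) (f : M →ₗ[A] N) :
    f m ∈ belowPart e k N := fun j hj a => by
  rw [← map_smul, ← map_smul, hm j hj, map_zero]

lemma belowPart_quotient_belowPart (he : CompleteOrthogonalIdempotents e) :
    belowPart e k (M ⧸ belowPart e k M) = ⊥ := by
  refine (Submodule.eq_bot_iff _).2 fun x hx => ?_
  obtain ⟨m, rfl⟩ := Submodule.mkQ_surjective _ x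
  refine (Submodule.Quotient.mk_eq_zero _).2 fun j hj a => ?_
  have h := hx j hj a
  rw [← map_smul, ← map_smul, Submodule.mkQ_apply, Submodule.Quotient.mk_eq_zero] at h
  have := h j hj (e j)
  rwa [smul_smul, he.idem, smul_smul, he.idem] at this

lemma smul_mem_aboveSpan {j : Fin n} (hj : k ≤ j) (m : M) : e j • m ∈ aboveSpan e k M :=
  Submodule.subset_span ⟨j, hj, m, rfl⟩

lemma isBelow_quotient_iff {U : Submodule A M} : IsBelow e k (M ⧸ U) ↔ aboveSpan e k M ≤ U := by
  refine ⟨fun h => Submodule.span_le.2 ?_, fun h j hj x => ?_⟩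
  · rintro _ ⟨j, hj, m, rfl⟩
    have := h j hj (U.mkQ m)
    rwa [← map_smul, Submodule.mkQ_apply, Submodule.Quotient.mk_eq_zero] at this
  · obtain ⟨m, rfl⟩ := U.mkQ_surjective x
    rw [← map_smul, Submodule.mkQ_apply, Submodule.Quotient.mk_eq_zero]
    exact h (smul_mem_aboveSpan hj m)

lemma isBelow_quotient_aboveSpan : IsBelow e k (M ⧸ aboveSpan e k M) :=
  isBelow_quotient_iff.2 le_rfl

lemma map_aboveSpan_le (f : M →ₗ[A] N) : (aboveSpan e k M).map f ≤ aboveSpan e k N := by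
  rw [aboveSpan, Submodule.map_span, Submodule.span_le]
  rintro _ ⟨_, ⟨j, hj, m, rfl⟩, rfl⟩
  rw [map_smul]
  exact smul_mem_aboveSpan hj _

/-- There are no nonzero homomorphisms from `aboveSpan e k M` to a module that is annihilated
by the idempotents `e j`, `k ≤ j`. -/
lemma hom_aboveSpan_eq_zero (he : CompleteOrthogonalIdempotents e) (hN : IsBelow e k N)
    (f : aboveSpan e k M →ₗ[A] N) : f = 0 := by
  ext ⟨x, hx⟩
  change f ⟨x, hx⟩ = 0
  induction hx using Submodule.span_induction with
  | mem x h =>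
    obtain ⟨j, hj, m, rfl⟩ := h
    have : (⟨e j • m, smul_mem_aboveSpan hj m⟩ : aboveSpan e k M)
        = e j • ⟨e j • m, smul_mem_aboveSpan hj m⟩ :=
      Subtype.ext (by simp [smul_smul, (he.idem j).eq])
    rw [this, map_smul, hN j hj]
  | zero => exact map_zero f
  | add x y hx hy h1 h2 =>
    have := map_add f ⟨x, hx⟩ ⟨y, hy⟩
    rw [h1, h2, add_zero] at this
    exact this
  | smul a x hx h =>
    have := map_smul f a ⟨x, hx⟩
    rw [h, smul_zero] at this
    exact this

end Below

/-! ### Standard modules -/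

section StandardModules

variable {A : Type u} [Ring A] {n : ℕ} {e : Fin n → A}

/-- The generator of the standard module `Δ(i)`. -/
def standardGen (e : Fin n → A) (i : Fin n) : standard e i :=
  Submodule.Quotient.mk (spanGen (e i))

lemma IsQuasiHereditary.smul_standardGen (hA : IsQuasiHereditary e) (i : Fin n) :
    e i • standardGen e i = standardGen e i := by
  change Submodule.Quotient.mk (e i • spanGen (e i)) = _
  rw [smul_spanGen_self (hA.idem i)]; rfl

lemma IsQuasiHereditary.exists_smul_standardGen (hA : IsQuasiHereditary e) {i : Fin n}
    (x : standard e i) : ∃ a : A, x = a • standardGen e i := by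
  obtain ⟨y, rfl⟩ := Submodule.mkQ_surjective _ x
  refine ⟨y, ?_⟩
  conv_lhs => rw [eq_smul_spanGen (hA.idem i) y]
  rfl

lemma IsQuasiHereditary.standardGen_ne_zero (hA : IsQuasiHereditary e) (i : Fin n) :
    standardGen e i ≠ 0 := by
  intro h
  have := (hA.schur i).1
  obtain ⟨f, hf⟩ := exists_ne (0 : Module.End A (standard e i))
  refine hf (LinearMap.ext fun x => ?_)
  obtain ⟨a, rfl⟩ := hA.exists_smul_standardGen x
  rw [h, smul_zero, map_zero, map_zero]

variable [IsArtinianRing A]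

lemma IsQuasiHereditary.noFactorAbove_iff (hA : IsQuasiHereditary e) {i : Fin n} {M : Type u}
    [AddCommGroup M] [Module A M] : NoFactorAbove e i M ↔ IsBelow e (i + 1) M := by
  refine forall_congr' fun j => ?_
  rw [isCompositionFactor_iff (hA.primitive j), not_exists]
  simp only [not_not]
  rfl

lemma IsQuasiHereditary.standardKernel_eq (hA : IsQuasiHereditary e) (i : Fin n) :
    standardKernel e i = aboveSpan e (i + 1) (P e i) := by
  refine le_antisymm (sInf_le ?_) (le_sInf fun U hU => ?_)
  · exact hA.noFactorAbove_iff.2 isBelow_quotient_aboveSpan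
  · exact isBelow_quotient_iff.1 (hA.noFactorAbove_iff.1 hU)

lemma IsQuasiHereditary.costandardIn_eq (hA : IsQuasiHereditary e) (i : Fin n) (I : Type u)
    [AddCommGroup I] [Module A I] : costandardIn e i I = belowPart e (i + 1) I := by
  refine le_antisymm (sSup_le fun U hU => ?_) (le_sSup ?_)
  · exact isBelow_submodule_iff.1 (hA.noFactorAbove_iff.1 hU)
  · exact hA.noFactorAbove_iff.2 isBelow_belowPart

lemma IsQuasiHereditary.isBelow_standard (hA : IsQuasiHereditary e) (i : Fin n) :
    IsBelow e (i + 1) (standard e i) := by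
  rw [isBelow_quotient_iff, hA.standardKernel_eq]

/-- Homomorphisms `Δ(i) → M` correspond to the elements of `e i • M` that generate a submodule
annihilated by the `e j`, `i < j`. -/
lemma IsQuasiHereditary.exists_standard_hom (hA : IsQuasiHereditary e) {i : Fin n} {M : Type*}
    [AddCommGroup M] [Module A M] {m : M} (hm : e i • m = m) (hm' : m ∈ belowPart e (i + 1) M) :
    ∃ f : standard e i →ₗ[A] M, f (standardGen e i) = m := by
  refine ⟨(standardKernel e i).liftQ (spanHom (e i) m) ?_, hm⟩
  rw [hA.standardKernel_eq, ← isBelow_quotient_iff]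
  have h : IsBelow e (i + 1) (LinearMap.range (spanHom (e i) m)) := by
    rw [isBelow_submodule_iff]
    rintro _ ⟨x, rfl⟩
    exact Submodule.smul_mem _ _ hm'
  exact h.of_injective (spanHom (e i) m).quotKerEquivRange.toLinearMap
    (spanHom (e i) m).quotKerEquivRange.injective

/-- The radical of `Δ(i)` is annihilated by `e i`, since a nonzero endomorphism of `Δ(i)` is
bijective and so does not have its image in the radical. -/
lemma IsQuasiHereditary.smul_radical_eq_zero (hA : IsQuasiHereditary e) (i : Fin n)
    {x : P e i} (hx : x ∈ Module.jacobson A (P e i)) :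
    e i • (Submodule.Quotient.mk x : standard e i) = 0 := by
  by_contra h
  set y : standard e i := e i • (Submodule.Quotient.mk x : standard e i) with hy
  obtain ⟨f, hf⟩ := hA.exists_standard_hom (m := y) (by rw [hy, smul_smul, hA.idem])
    (by rw [isBelow_iff_belowPart_eq_top.1 (hA.isBelow_standard i)]; trivial)
  have hu := (hA.schur i).2 f (fun h0 => h (by rw [← hf, h0, LinearMap.zero_apply]))
  have hsurj := ((Module.End.isUnit_iff f).1 hu).2
  obtain ⟨z, hz⟩ := hsurj (standardGen e i)
  obtain ⟨a, rfl⟩ := hA.exists_smul_standardGen z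
  rw [map_smul, hf, hy] at hz
  have hz' : spanGen (e i) - a • e i • x ∈ standardKernel e i := by
    rw [← Submodule.Quotient.mk_eq_zero, Submodule.Quotient.mk_sub, sub_eq_zero]
    exact hz.symm
  have hK : standardKernel e i ≠ ⊤ := by
    intro hK
    exact hA.standardGen_ne_zero i
      ((Submodule.Quotient.mk_eq_zero _).2 (hK ▸ Submodule.mem_top))
  have h1 := (hA.primitive i).le_jacobson hK hz'
  have h2 : a • e i • x ∈ Module.jacobson A (P e i) :=
    Submodule.smul_mem _ _ (Submodule.smul_mem _ _ hx)
  have h3 := Submodule.add_mem _ h1 h2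
  rw [sub_add_cancel] at h3
  exact (hA.primitive i).isCoatom_jacobson.1 (eq_top_of_spanGen_mem (hA.idem i) h3)

end StandardModules

/-! ### Injective envelopes -/

section InjectiveEnvelope

variable {A : Type u} [Ring A]

/-- A direct summand of an injective module is injective. -/
lemma injective_of_retract {J M : Type u} [AddCommGroup J] [Module A J] [AddCommGroup M]
    [Module A M] (hJ : Module.Injective A J) (i : M →ₗ[A] J) (p : J →ₗ[A] M)
    (hpi : ∀ m, p (i m) = m) : Module.Injective A M where
  out X Y _ _ _ _ f hf g := by
    obtain ⟨h, hh⟩ := hJ.out f hf (i ∘ₗ g)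
    exact ⟨p ∘ₗ h, fun x => by simp [hh, hpi]⟩

/-- Every module has an injective envelope: a maximal essential extension inside an injective
module `J` is a direct summand of `J`. -/
theorem exists_isInjectiveEnvelope (E : Type u) [AddCommGroup E] [Module A E] :
    ∃ (I : ModuleCat.{u} A) (ι : E →ₗ[A] I), IsInjectiveEnvelope ι := by
  obtain ⟨⟨J, hJ, f, hf⟩⟩ := EnoughInjectives.presentation (ModuleCat.of A E)
  have hJ : Module.Injective A J := Module.injective_module_of_injective_object A J
  replace hf : Function.Injective f.hom := (ModuleCat.mono_iff_injective f).1 hf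
  let F : E →ₗ[A] J := f.hom
  let R := LinearMap.range F
  obtain ⟨M, hRM, hM⟩ := zorn_le_nonempty₀
    {U : Submodule A J | ∀ N ≤ U, N ⊓ R = ⊥ → N = ⊥} (by
      intro c hc hchain y hy
      refine ⟨sSup c, fun N hN hNR => ?_, fun z hz => le_sSup hz⟩
      refine (Submodule.eq_bot_iff _).2 fun x hx => ?_
      obtain ⟨U, hU, hxU⟩ := (Submodule.mem_sSup_of_directed ⟨y, hy⟩ hchain.directedOn).1 (hN hx)
      have hsp : Submodule.span A {x} ≤ N := by simpa using hx
      have := hc hU (Submodule.span A {x}) (by simpa using hxU)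
        (eq_bot_iff.2 (hNR ▸ inf_le_inf_right R hsp))
      simpa using this)
    R (fun N hN hNR => by rwa [inf_eq_left.2 hN] at hNR)
  obtain ⟨C, -, hC⟩ := zorn_le_nonempty₀ {C : Submodule A J | Disjoint M C} (by
      intro c hc hchain y hy
      exact ⟨sSup c, hchain.directedOn.disjoint_sSup_right.2 fun b hb => hc hb,
        fun z hz => le_sSup hz⟩)
    ⊥ disjoint_bot_right
  have hMC : Disjoint M C := hC.prop
  have hinj : Function.Injective (C.mkQ ∘ₗ M.subtype) := by
    rw [← LinearMap.ker_eq_bot, LinearMap.ker_comp, Submodule.ker_mkQ,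
      ← Submodule.disjoint_iff_comap_eq_bot]
    exact hMC
  obtain ⟨h, hh⟩ := hJ.out (C.mkQ ∘ₗ M.subtype) hinj M.subtype
  let p : J →ₗ[A] J := h ∘ₗ C.mkQ
  have hp : ∀ m ∈ M, p m = m := fun m hm => hh ⟨m, hm⟩
  have hCp : C ≤ LinearMap.ker p := fun x hx => by
    change h (C.mkQ x) = 0
    rw [Submodule.mkQ_apply, (Submodule.Quotient.mk_eq_zero C).2 hx, map_zero]
  -- the image of `p` is an essential extension of `R`
  have hess : ∀ N ≤ LinearMap.range p, N ⊓ R = ⊥ → N = ⊥ := by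
    intro N hN hNR
    have hNM : N ⊓ M = ⊥ := by
      refine hM.prop _ inf_le_right ?_
      rw [inf_assoc, inf_eq_right.2 hRM, hNR]
    have hle : C ≤ N.comap p := fun x hx => by
      rw [Submodule.mem_comap, LinearMap.mem_ker.1 (hCp hx)]; exact N.zero_mem
    have heq : N.comap p ≤ C := by
      refine hC.2 ?_ hle
      refine Submodule.disjoint_def.2 fun x hx hx' => ?_
      have : x ∈ N ⊓ M := ⟨by rw [← hp x hx]; exact hx', hx⟩
      rwa [hNM] at this
    refine (Submodule.eq_bot_iff _).2 fun x hx => ?_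
    obtain ⟨y, rfl⟩ := hN hx
    exact hCp (heq hx)
  have hMp : M ≤ LinearMap.range p := fun m hm => ⟨m, hp m hm⟩
  have hpM : LinearMap.range p ≤ M := hM.2 hess hMp
  have hMinj : Module.Injective A M :=
    injective_of_retract hJ M.subtype (p.codRestrict M fun x => hpM ⟨x, rfl⟩)
      fun m => Subtype.ext (hp m m.2)
  refine ⟨ModuleCat.of A M, F.codRestrict M fun x => hRM ⟨x, rfl⟩, hMinj, ?_, ?_⟩
  · intro x y hxy
    exact hf (congrArg Subtype.val hxy)
  · intro N hN
    have : N.map M.subtype = ⊥ := by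
      refine hM.prop _ (Submodule.map_subtype_le M N) ?_
      refine (Submodule.eq_bot_iff _).2 ?_
      rintro _ ⟨⟨x, hx, rfl⟩, y, hy⟩
      have : x ∈ N ⊓ LinearMap.range (F.codRestrict M fun x => hRM ⟨x, rfl⟩) :=
        ⟨hx, y, Subtype.ext hy⟩
      rw [hN, Submodule.mem_bot] at this
      rw [this, map_zero]
    exact Submodule.map_injective_of_injective M.injective_subtype
      (this.trans (Submodule.map_bot _).symm)

end InjectiveEnvelope

/-! ### Socles -/

section Socle

variable {A : Type u} [Ring A] {n : ℕ} {e : Fin n → A}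

lemma IsQuasiHereditary.range_E_hom (hA : IsQuasiHereditary e) {i : Fin n} {Z : Type*}
    [AddCommGroup Z] [Module A Z] (φ : E e i →ₗ[A] Z) :
    LinearMap.range φ = Submodule.span A {φ (topGen e i)} := by
  refine le_antisymm ?_ (by simp)
  rintro _ ⟨x, rfl⟩
  obtain ⟨y, rfl⟩ := Submodule.mkQ_surjective _ x
  have : (Module.jacobson A (P e i)).mkQ y = (y : A) • topGen e i := by
    conv_lhs => rw [eq_smul_spanGen (hA.idem i) y]
    rfl
  rw [this, map_smul]
  exact Submodule.smul_mem _ _ (Submodule.mem_span_singleton_self _)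

lemma IsQuasiHereditary.exists_smul_ne_zero (hA : IsQuasiHereditary e) {i : Fin n} {Z : Type*}
    [AddCommGroup Z] [Module A Z] (hZ : IsBelow e (i + 1) Z) (hZ' : belowPart e i Z = ⊥)
    {U : Submodule A Z} (hU : U ≠ ⊥) : ∃ z ∈ U, e i • z = z ∧ z ≠ 0 := by
  by_contra! h
  refine hU (eq_bot_iff.2 ?_)
  rw [← hZ', ← isBelow_submodule_iff]
  intro j hj m
  rcases eq_or_ne j i with rfl | hne
  · refine Subtype.ext (h _ (e j • m).2 ?_)
    rw [Submodule.coe_smul, smul_smul, hA.idem]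
  · exact hZ.submodule U j (by have := Fin.val_ne_of_ne hne; lia) _

variable [IsArtinianRing A]

/-- If `e j` kills `Z` for `j > i` and no nonzero submodule of `Z` is killed by all `e j`, `j ≥ i`,
then the nonzero elements of `e i • Z` generate simple submodules isomorphic to `E(i)`. -/
lemma IsQuasiHereditary.exists_E_hom (hA : IsQuasiHereditary e) {i : Fin n} {Z : Type*}
    [AddCommGroup Z] [Module A Z] (hZ : IsBelow e (i + 1) Z) (hZ' : belowPart e i Z = ⊥)
    {z : Z} (hz : e i • z = z) (hz0 : z ≠ 0) :
    ∃ φ : E e i →ₗ[A] Z, Function.Injective φ ∧ φ (topGen e i) = z := by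
  obtain ⟨F, hF⟩ := hA.exists_standard_hom hz
    (by rw [isBelow_iff_belowPart_eq_top.1 hZ]; trivial)
  let f : P e i →ₗ[A] Z := F ∘ₗ (standardKernel e i).mkQ
  have hJ : Module.jacobson A (P e i) ≤ LinearMap.ker f := by
    intro x hx
    rw [LinearMap.mem_ker, ← Submodule.mem_bot A, ← hZ']
    intro j hj a
    rcases eq_or_ne j i with rfl | hne
    · have := hA.smul_radical_eq_zero j (Submodule.smul_mem _ a hx)
      rw [← map_smul, ← map_smul]
      change F (e j • (standardKernel e j).mkQ (a • x)) = 0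
      rw [Submodule.mkQ_apply, this, map_zero]
    · exact hZ j (by have := Fin.val_ne_of_ne hne; lia) _
  let φ : E e i →ₗ[A] Z := (Module.jacobson A (P e i)).liftQ f hJ
  have hφ : φ (topGen e i) = z := hF
  have := hA.isSimpleModule_E i
  refine ⟨φ, LinearMap.injective_of_ne_zero fun h => hz0 ?_, hφ⟩
  rw [← hφ, h, LinearMap.zero_apply]

lemma IsQuasiHereditary.isSimpleModule_span (hA : IsQuasiHereditary e) {i : Fin n} {Z : Type*}
    [AddCommGroup Z] [Module A Z] (hZ : IsBelow e (i + 1) Z) (hZ' : belowPart e i Z = ⊥)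
    {z : Z} (hz : e i • z = z) (hz0 : z ≠ 0) : IsSimpleModule A (Submodule.span A {z}) := by
  obtain ⟨φ, hφ, rfl⟩ := hA.exists_E_hom hZ hZ' hz hz0
  rw [← hA.range_E_hom]
  have := hA.isSimpleModule_E i
  exact IsSimpleModule.congr (LinearEquiv.ofInjective φ hφ).symm

/-- Under the same assumptions, the submodule generated by `e i • Z` is a finite direct sum
of copies of `E(i)`. -/
lemma IsQuasiHereditary.exists_aboveSpan_equiv (hA : IsQuasiHereditary e) {i : Fin n} {Z : Type u}
    [AddCommGroup Z] [Module A Z] [Module.Finite A Z] (hZ : IsBelow e (i + 1) Z)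
    (hZ' : belowPart e i Z = ⊥) :
    ∃ m : ℕ, Nonempty (aboveSpan e i Z ≃ₗ[A] (Fin m → E e i)) := by
  have hS : aboveSpan e i Z = ⨆ z : Z, Submodule.span A {e i • z} := by
    refine le_antisymm (Submodule.span_le.2 ?_) (iSup_le fun z => ?_)
    · rintro _ ⟨j, hj, z, rfl⟩
      rcases eq_or_ne j i with rfl | hne
      · exact Submodule.mem_iSup_of_mem z (Submodule.mem_span_singleton_self _)
      · rw [hZ j (by have := Fin.val_ne_of_ne hne; lia)]
        exact Submodule.zero_mem _
    · rw [Submodule.span_singleton_le_iff_mem]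
      exact smul_mem_aboveSpan le_rfl z
  have hss : IsSemisimpleModule A (aboveSpan e i Z) := by
    have := isSemisimpleModule_biSup_of_isSemisimpleModule_submodule (R := A) (s := Set.univ)
      (p := fun z : Z => Submodule.span A {e i • z}) (fun z _ => by
        rcases eq_or_ne (e i • z) 0 with h0 | h0
        · have := hA.isSimpleModule_E i
          rw [h0, Submodule.span_zero_singleton]
          exact IsSemisimpleModule.of_injective (0 : _ →ₗ[A] E e i)
            (Function.injective_of_subsingleton _)
        · have := hA.isSimpleModule_span hZ hZ' (by rw [smul_smul, hA.idem]) h0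
          infer_instance)
    rw [hS, ← iSup_univ]
    exact this
  have hfin : Module.Finite A (aboveSpan e i Z) := inferInstance
  have hiso : IsIsotypicOfType A (aboveSpan e i Z) (E e i) := by
    intro m hm
    have hE := hA.isSimpleModule_E i
    have hB : belowPart e i (aboveSpan e i Z) = ⊥ := by
      refine (Submodule.eq_bot_iff _).2 fun x hx => Subtype.ext ?_
      have := map_mem_belowPart hx (aboveSpan e i Z).subtype
      rwa [hZ', Submodule.mem_bot] at this
    obtain ⟨z, hzm, hz, hz0⟩ := hA.exists_smul_ne_zero (hZ.submodule _) hB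
      (U := m) (fun h => by
        have := IsSimpleModule.nontrivial A m
        exact not_subsingleton m ((Submodule.subsingleton_iff_eq_bot).2 h))
    obtain ⟨φ, hφ, hφz⟩ := hA.exists_E_hom (hZ.submodule _) hB hz hz0
    have hle : ∀ x, φ x ∈ m := by
      intro x
      have : φ x ∈ LinearMap.range φ := ⟨x, rfl⟩
      rw [hA.range_E_hom, hφz] at this
      exact (Submodule.span_singleton_le_iff_mem _ _).2 hzm this
    let ψ : E e i →ₗ[A] m := φ.codRestrict m hle
    have hψ : ψ ≠ 0 := fun h => hz0 (by
      rw [← hφz]; exact congrArg Subtype.val (LinearMap.congr_fun h (topGen e i)))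
    exact ⟨(LinearEquiv.ofBijective ψ (LinearMap.bijective_of_ne_zero hψ)).symm⟩
  have := hA.isSimpleModule_E i
  exact hiso.linearEquiv_fun

end Socle

/-! ### Costandard modules -/

section Costandard

variable {A : Type u} [Ring A] {n : ℕ} (e : Fin n → A)

/-- An injective envelope of the simple module `E(i)`. -/
noncomputable def envelope (i : Fin n) : ModuleCat.{u} A :=
  (exists_isInjectiveEnvelope (E e i)).choose

/-- The embedding of `E(i)` in its injective envelope. -/
noncomputable def envelopeEmb (i : Fin n) : E e i →ₗ[A] envelope e i :=
  (exists_isInjectiveEnvelope (E e i)).choose_spec.choose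

lemma isInjectiveEnvelope_envelopeEmb (i : Fin n) : IsInjectiveEnvelope (envelopeEmb e i) :=
  (exists_isInjectiveEnvelope (E e i)).choose_spec.choose_spec

/-- The costandard module `∇(i)`, as a submodule of a chosen injective envelope of `E(i)`. -/
abbrev costandard (i : Fin n) : Type u := costandardIn e i (envelope e i)

variable {e} [IsArtinianRing A]

lemma IsQuasiHereditary.isBelow_costandard (hA : IsQuasiHereditary e) (i : Fin n) :
    IsBelow e (i + 1) (costandard e i) := by
  rw [isBelow_submodule_iff, hA.costandardIn_eq]

/-- `∇(i)` is injective relative to the modules annihilated by the `e j`, `i < j`. -/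
lemma IsQuasiHereditary.exists_extend_costandard (hA : IsQuasiHereditary e) {i : Fin n}
    {X Y : Type u} [AddCommGroup X] [Module A X] [AddCommGroup Y] [Module A Y]
    (hY : IsBelow e (i + 1) Y) (f : X →ₗ[A] Y) (hf : Function.Injective f)
    (g : X →ₗ[A] costandard e i) : ∃ h : Y →ₗ[A] costandard e i, ∀ x, h (f x) = g x := by
  obtain ⟨h, hh⟩ := (isInjectiveEnvelope_envelopeEmb e i).isInjective.out f hf
    ((costandardIn e i (envelope e i)).subtype ∘ₗ g)
  have hle : ∀ y, h y ∈ costandardIn e i (envelope e i) := by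
    intro y
    rw [hA.costandardIn_eq]
    exact hY.range_le h ⟨y, rfl⟩
  exact ⟨h.codRestrict _ hle, fun x => Subtype.ext (hh x)⟩

lemma IsQuasiHereditary.isBelow_E (hA : IsQuasiHereditary e) (i : Fin n) :
    IsBelow e (i + 1) (E e i) :=
  fun _ hj x => hA.smul_E_eq_zero (fun h => by subst h; lia) x

/-- The embedding of `E(i)` as the socle of `∇(i)`. -/
noncomputable def IsQuasiHereditary.socleEmb (hA : IsQuasiHereditary e) (i : Fin n) :
    E e i →ₗ[A] costandard e i :=
  (envelopeEmb e i).codRestrict _ fun x => by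
    rw [hA.costandardIn_eq]
    exact (hA.isBelow_E i).range_le _ ⟨x, rfl⟩

lemma IsQuasiHereditary.injective_socleEmb (hA : IsQuasiHereditary e) (i : Fin n) :
    Function.Injective (hA.socleEmb i) := fun _ _ h =>
  (isInjectiveEnvelope_envelopeEmb e i).mono (congrArg Subtype.val h)

lemma IsQuasiHereditary.range_socleEmb_le (hA : IsQuasiHereditary e) {i : Fin n}
    {N : Submodule A (costandard e i)} (hN : N ≠ ⊥) : LinearMap.range (hA.socleEmb i) ≤ N := by
  have hE := hA.isSimpleModule_E i
  have hne : (N.comap (hA.socleEmb i)) ≠ ⊥ := by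
    intro h
    apply hN
    have h1 : N.map (costandardIn e i (envelope e i)).subtype = ⊥ := by
      refine (isInjectiveEnvelope_envelopeEmb e i).essential _ ?_
      refine (Submodule.eq_bot_iff _).2 ?_
      rintro _ ⟨⟨x, hx, rfl⟩, y, hy⟩
      have hxy : hA.socleEmb i y = x := Subtype.ext hy
      have : y ∈ N.comap (hA.socleEmb i) := by rw [Submodule.mem_comap, hxy]; exact hx
      rw [h, Submodule.mem_bot] at this
      rw [← hxy, this, map_zero, map_zero]
    exact Submodule.map_injective_of_injective (Submodule.injective_subtype _)
      (h1.trans (Submodule.map_bot _).symm)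
  have htop := (eq_bot_or_eq_top (N.comap (hA.socleEmb i))).resolve_left hne
  rintro _ ⟨x, rfl⟩
  exact (htop ▸ Submodule.mem_top : x ∈ N.comap (hA.socleEmb i))

lemma IsQuasiHereditary.belowPart_costandard (hA : IsQuasiHereditary e) (i : Fin n) :
    belowPart e i (costandard e i) = ⊥ := by
  by_contra h
  have h1 := hA.range_socleEmb_le h ⟨topGen e i, rfl⟩
  have h2 := h1 i le_rfl 1
  rw [one_smul, ← map_smul, smul_topGen (hA.primitive i)] at h2
  exact topGen_ne_zero (hA.primitive i) (hA.injective_socleEmb i (by rw [h2, map_zero]))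

/-- `E(i)` is a composition factor of `∇(i)` of multiplicity one, its socle. -/
lemma IsQuasiHereditary.smul_costandard_mem (hA : IsQuasiHereditary e) {i : Fin n}
    (v : costandard e i) : e i • v ∈ LinearMap.range (hA.socleEmb i) := by
  rcases eq_or_ne (e i • v) 0 with h0 | h0
  · rw [h0]; exact Submodule.zero_mem _
  have hs := hA.isSimpleModule_span (hA.isBelow_costandard i) (hA.belowPart_costandard i)
    (by rw [smul_smul, hA.idem]) h0
  have hle : LinearMap.range (hA.socleEmb i) ≤ Submodule.span A {e i • v} :=
    hA.range_socleEmb_le (by simpa using h0)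
  have hat := isSimpleModule_iff_isAtom.1 hs
  rcases hat.le_iff.1 hle with h | h
  · exact absurd (hA.injective_socleEmb i
      (show _ = hA.socleEmb i 0 by rw [LinearMap.range_eq_bot.1 h]; rfl))
      (topGen_ne_zero (hA.primitive i))
  · rw [h]; exact Submodule.mem_span_singleton_self _

lemma IsQuasiHereditary.standard_hom_costandard_eq_zero (hA : IsQuasiHereditary e) {i j : Fin n}
    (hij : i < j) (f : standard e i →ₗ[A] costandard e j) : f = 0 := by
  have h : LinearMap.range f ≤ ⊥ := by
    rw [← hA.belowPart_costandard j]
    exact ((hA.isBelow_standard i).range_le f).trans (belowPart_mono (by exact_mod_cast hij))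
  exact LinearMap.range_eq_bot.1 (le_bot_iff.1 h)

end Costandard

/-! ### Vanishing of Ext groups -/

section ExtVanishing

open Abelian

variable (A : Type u) [Ring A]

/-- `Ext^k(X, Y) = 0`. -/
def ExtVanish (k : ℕ) (X Y : Type u) [AddCommGroup X] [Module A X] [AddCommGroup Y]
    [Module A Y] : Prop :=
  ∀ x : Ext.{u} (ModuleCat.of A X) (ModuleCat.of A Y) k, x = 0

variable {A} {k : ℕ} {X Y Z W : Type u} [AddCommGroup X] [Module A X] [AddCommGroup Y]
  [Module A Y] [AddCommGroup Z] [Module A Z] [AddCommGroup W] [Module A W]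

lemma extVanish_zero_iff : ExtVanish A 0 X Y ↔ ∀ f : X →ₗ[A] Y, f = 0 := by
  refine ⟨fun h f => ?_, fun h x => ?_⟩
  · have := h (Ext.mk₀ (ModuleCat.ofHom f))
    rw [Ext.mk₀_eq_zero_iff] at this
    exact congrArg ModuleCat.Hom.hom this
  · obtain ⟨f, rfl⟩ := (Ext.mk₀_bijective _ _).2 x
    rw [Ext.mk₀_eq_zero_iff]
    exact ModuleCat.hom_ext (h f.hom)

lemma extVanish_of_projective [Module.Projective A X] : ExtVanish A (k + 1) X Y :=
  fun x => Ext.eq_zero_of_projective x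

lemma extVanish_of_injective (h : Module.Injective A Y) : ExtVanish A (k + 1) X Y := by
  have : Injective (ModuleCat.of A Y) := (Module.injective_iff_injective_object A Y).1 h
  exact fun x => Ext.eq_zero_of_injective x

lemma ExtVanish.of_retract_left (h : ExtVanish A k Y W) (i : X →ₗ[A] Y) (p : Y →ₗ[A] X)
    (hpi : p ∘ₗ i = LinearMap.id) : ExtVanish A k X W := fun x => by
  have h1 := h ((Ext.mk₀ (ModuleCat.ofHom p)).comp x (zero_add k))
  have h2 : (Ext.mk₀ (ModuleCat.ofHom i)).comp
      ((Ext.mk₀ (ModuleCat.ofHom p)).comp x (zero_add k)) (zero_add k) = x := by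
    rw [Ext.mk₀_comp_mk₀_assoc, ← ModuleCat.ofHom_comp, hpi]
    exact Ext.mk₀_id_comp x
  rw [← h2, h1, Ext.comp_zero]

lemma ExtVanish.of_retract_right (h : ExtVanish A k W Y) (i : X →ₗ[A] Y) (p : Y →ₗ[A] X)
    (hpi : p ∘ₗ i = LinearMap.id) : ExtVanish A k W X := fun x => by
  have h1 := h (x.comp (Ext.mk₀ (ModuleCat.ofHom i)) (add_zero k))
  have h2 : (x.comp (Ext.mk₀ (ModuleCat.ofHom i)) (add_zero k)).comp
      (Ext.mk₀ (ModuleCat.ofHom p)) (add_zero k) = x := by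
    rw [Ext.comp_assoc_of_second_deg_zero, Ext.mk₀_comp_mk₀, ← ModuleCat.ofHom_comp, hpi]
    exact Ext.comp_mk₀_id x
  rw [← h2, h1, Ext.zero_comp]

lemma ExtVanish.congr_left (h : ExtVanish A k Y W) (φ : X ≃ₗ[A] Y) : ExtVanish A k X W :=
  h.of_retract_left φ.toLinearMap φ.symm.toLinearMap (by ext; simp)

lemma ExtVanish.congr_right (h : ExtVanish A k W Y) (φ : X ≃ₗ[A] Y) : ExtVanish A k W X :=
  h.of_retract_right φ.toLinearMap φ.symm.toLinearMap (by ext; simp)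

lemma extVanish_of_subsingleton_left [Subsingleton X] : ExtVanish A k X Y := fun x => by
  rw [← Ext.mk₀_id_comp x,
    show 𝟙 (ModuleCat.of A X) = 0 from ModuleCat.hom_ext (LinearMap.ext fun _ =>
      Subsingleton.elim (α := X) _ _), Ext.mk₀_zero, Ext.zero_comp]

lemma extVanish_of_subsingleton_right [Subsingleton Y] : ExtVanish A k X Y := fun x => by
  rw [← Ext.comp_mk₀_id x,
    show 𝟙 (ModuleCat.of A Y) = 0 from ModuleCat.hom_ext (LinearMap.ext fun _ =>
      Subsingleton.elim (α := Y) _ _), Ext.mk₀_zero, Ext.comp_zero]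

/-- The short exact sequence of modules given by linear maps. -/
lemma exists_shortExact {f : X →ₗ[A] Y} {g : Y →ₗ[A] Z} (hf : Function.Injective f)
    (hfg : Function.Exact f g) (hg : Function.Surjective g) :
    (ModuleCat.shortComplexOfCompEqZero f g hfg.linearMap_comp_eq_zero).ShortExact :=
  ModuleCat.shortComplex_shortExact _ hfg hf hg

section Exact

variable {f : X →ₗ[A] Y} {g : Y →ₗ[A] Z} (hf : Function.Injective f)
    (hfg : Function.Exact f g) (hg : Function.Surjective g)
include hf hfg hg

lemma ExtVanish.mid_right (h₁ : ExtVanish A k W X) (h₃ : ExtVanish A k W Z) :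
    ExtVanish A k W Y := fun x => by
  obtain ⟨y, rfl⟩ := Ext.covariant_sequence_exact₂ _ (exists_shortExact hf hfg hg) x (h₃ _)
  rw [h₁ y, Ext.zero_comp]

lemma ExtVanish.fst_right (h₃ : ExtVanish A k W Z) (h₂ : ExtVanish A (k + 1) W Y) :
    ExtVanish A (k + 1) W X := fun x => by
  obtain ⟨y, rfl⟩ := Ext.covariant_sequence_exact₁ _ (exists_shortExact hf hfg hg) x (h₂ _) rfl
  rw [h₃ y, Ext.zero_comp]

lemma ExtVanish.thd_right (h₂ : ExtVanish A k W Y) (h₁ : ExtVanish A (k + 1) W X) :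
    ExtVanish A k W Z := fun x => by
  obtain ⟨y, rfl⟩ := Ext.covariant_sequence_exact₃ _ (exists_shortExact hf hfg hg) x rfl (h₁ _)
  rw [h₂ y, Ext.zero_comp]

lemma ExtVanish.mid_left (h₁ : ExtVanish A k X W) (h₃ : ExtVanish A k Z W) :
    ExtVanish A k Y W := fun x => by
  obtain ⟨y, rfl⟩ := Ext.contravariant_sequence_exact₂ (exists_shortExact hf hfg hg) _ x (h₁ _)
  rw [h₃ y, Ext.comp_zero]

lemma ExtVanish.thd_left (h₁ : ExtVanish A k X W) (h₂ : ExtVanish A (k + 1) Y W) :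
    ExtVanish A (k + 1) Z W := fun x => by
  obtain ⟨y, rfl⟩ := Ext.contravariant_sequence_exact₃ (exists_shortExact hf hfg hg) _ x (h₂ _)
    (add_comm 1 k)
  rw [h₁ y, Ext.comp_zero]

lemma ExtVanish.fst_left (h₂ : ExtVanish A k Y W) (h₃ : ExtVanish A (k + 1) Z W) :
    ExtVanish A k X W := fun x => by
  obtain ⟨y, rfl⟩ := Ext.contravariant_sequence_exact₁ (exists_shortExact hf hfg hg) _ x
    (add_comm 1 k) (h₃ _)
  rw [h₂ y, Ext.comp_zero]

/-- If `Ext^1(W, X) = 0`, homomorphisms from `W` to the quotient of `Y` by `X` lift to `Y`. -/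
lemma ExtVanish.exists_lift (h : ExtVanish A 1 W X) (φ : W →ₗ[A] Z) :
    ∃ ψ : W →ₗ[A] Y, g ∘ₗ ψ = φ := by
  obtain ⟨y, hy⟩ := Ext.covariant_sequence_exact₃ (ModuleCat.of A W) (exists_shortExact hf hfg hg)
    (Ext.mk₀ (ModuleCat.ofHom φ)) rfl (h _)
  obtain ⟨ψ, rfl⟩ := (Ext.mk₀_bijective _ _).2 y
  rw [Ext.mk₀_comp_mk₀] at hy
  exact ⟨ψ.hom, congrArg ModuleCat.Hom.hom ((Ext.mk₀_bijective _ _).1 hy)⟩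

end Exact

lemma ofHom_sum_pi (m : ℕ) :
    𝟙 (ModuleCat.of A (Fin m → X)) = ∑ i : Fin m,
      ModuleCat.ofHom (LinearMap.proj (R := A) (φ := fun _ : Fin m => X) i) ≫
        ModuleCat.ofHom (LinearMap.single A (fun _ : Fin m => X) i) := by
  ext x j
  simp [ModuleCat.hom_sum, Finset.sum_apply, Pi.single_apply]

lemma ExtVanish.pi_left (h : ExtVanish A k X W) (m : ℕ) : ExtVanish A k (Fin m → X) W :=
  fun x => by
  rw [← Ext.mk₀_id_comp x, ofHom_sum_pi, Ext.mk₀_sum, Ext.sum_comp]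
  refine Finset.sum_eq_zero fun i _ => ?_
  rw [← Ext.mk₀_comp_mk₀_assoc, h (Ext.comp _ _ _), Ext.comp_zero]

lemma ExtVanish.pi_right (h : ExtVanish A k W X) (m : ℕ) : ExtVanish A k W (Fin m → X) :=
  fun x => by
  rw [← Ext.comp_mk₀_id x, ofHom_sum_pi, Ext.mk₀_sum, Ext.comp_sum]
  refine Finset.sum_eq_zero fun i _ => ?_
  rw [← Ext.mk₀_comp_mk₀, ← Ext.comp_assoc_of_second_deg_zero, h (Ext.comp _ _ _),
    Ext.zero_comp]

lemma exact_subtype_mkQ (N : Submodule A X) : Function.Exact N.subtype N.mkQ :=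
  LinearMap.exact_iff.2 (by simp)

end ExtVanishing

/-! ### Modules with filtrations -/

section Filtrations

variable {A : Type u} [Ring A] {Θ : ObjectProperty (ModuleCat.{u} A)}

lemma prop_of_linearEquiv [Θ.IsClosedUnderIsomorphisms] {X Y : Type u} [AddCommGroup X]
    [Module A X] [AddCommGroup Y] [Module A Y] (φ : X ≃ₗ[A] Y) (h : Θ (ModuleCat.of A X)) :
    Θ (ModuleCat.of A Y) :=
  Θ.prop_of_iso φ.toModuleIso h

/-- The isomorphism of quotients induced by an isomorphism. -/
def quotientEquiv {X Y : Type u} [AddCommGroup X] [Module A X] [AddCommGroup Y] [Module A Y]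
    {U : Submodule A X} {U' : Submodule A Y} (φ : X ≃ₗ[A] Y) (h : ∀ x, x ∈ U ↔ φ x ∈ U') :
    (X ⧸ U) ≃ₗ[A] (Y ⧸ U') :=
  Submodule.Quotient.equiv U U' φ (by
    ext y
    rw [Submodule.mem_map_equiv, h, LinearEquiv.apply_symm_apply])

/-- Induction along a filtration, adding one factor at the top at a time. -/
theorem Filtered.induction [Θ.IsClosedUnderIsomorphisms]
    {P : ∀ (M : Type u) [AddCommGroup M] [Module A M], Prop}
    (zero : ∀ (M : Type u) [AddCommGroup M] [Module A M], Subsingleton M → P M)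
    (step : ∀ (M : Type u) [AddCommGroup M] [Module A M] (N : Submodule A M), P N →
      Θ (ModuleCat.of A (M ⧸ N)) → P M)
    (M : Type u) [AddCommGroup M] [Module A M] (hM : Filtered Θ (ModuleCat.of A M)) : P M := by
  obtain ⟨t, F, h0, ht, hF⟩ := hM
  change ℕ → Submodule A M at F
  induction t generalizing M with
  | zero =>
    exact zero M ((Submodule.subsingleton_iff A).1 (subsingleton_of_bot_eq_top (ht.symm.trans h0)))
  | succ t ih =>
    refine step M (F 1) (ih _ (fun i => (F (i + 1)).submoduleOf (F 1)) ?_ ?_ ?_) ?_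
    · exact Submodule.submoduleOf_self _
    · change (F (t + 1)).submoduleOf (F 1) = ⊥
      rw [ht, Submodule.eq_bot_iff]
      exact fun x hx => Subtype.ext hx
    · intro i hi
      have hle : ∀ i, i < t + 1 → F (i + 1) ≤ F 1 := by
        intro i
        induction i with
        | zero => exact fun _ => le_rfl
        | succ i ih => exact fun hi => (hF (i + 1) hi).1.trans (ih (by lia))
      obtain ⟨h1, h2⟩ := hF (i + 1) (by lia)
      refine ⟨Submodule.comap_mono h1, prop_of_linearEquiv (quotientEquiv
        (Submodule.submoduleOfEquivOfLe (hle i (by lia))).symm fun x => Iff.rfl) h2⟩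
    · exact prop_of_linearEquiv (quotientEquiv (LinearEquiv.ofTop (F 0) h0) fun x => Iff.rfl)
        (hF 0 (by lia)).2

lemma filtered_of_subsingleton (M : Type u) [AddCommGroup M] [Module A M] [Subsingleton M] :
    Filtered Θ (ModuleCat.of A M) :=
  ⟨0, fun _ => ⊥, Subsingleton.elim (α := Submodule A M) _ _, rfl, fun i hi => absurd hi (by lia)⟩

lemma filtered_of_submodule [Θ.IsClosedUnderIsomorphisms] {M : Type u} [AddCommGroup M]
    [Module A M] {N : Submodule A M} (hN : Filtered Θ (ModuleCat.of A N))
    (h : Θ (ModuleCat.of A (M ⧸ N))) : Filtered Θ (ModuleCat.of A M) := by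
  obtain ⟨t, F, h0, ht, hF⟩ := hN
  change ℕ → Submodule A N at F
  let G : ℕ → Submodule A M := fun i => Nat.casesOn i ⊤ fun i => (F i).map N.subtype
  refine ⟨t + 1, G, rfl, ?_, ?_⟩
  · change (F t).map N.subtype = ⊥
    rw [ht]; exact Submodule.map_bot _
  · rintro (_ | i) hi
    · refine ⟨le_top, ?_⟩
      change Θ (ModuleCat.of A ((⊤ : Submodule A M) ⧸ (G 1).submoduleOf ⊤))
      refine prop_of_linearEquiv (quotientEquiv Submodule.topEquiv.symm fun x => ?_) h
      change x ∈ N ↔ x ∈ (F 0).map N.subtype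
      rw [h0, Submodule.map_top, Submodule.range_subtype]
    · obtain ⟨h1, h2⟩ := hF i (by lia)
      refine ⟨Submodule.map_mono h1, prop_of_linearEquiv (quotientEquiv
        (Submodule.equivMapOfInjective _ N.injective_subtype (F i)) fun x => ?_) h2⟩
      change (x : N) ∈ F (i + 1) ↔ N.subtype x ∈ (F (i + 1)).map N.subtype
      exact (N.injective_subtype.mem_set_image (s := F (i + 1))).symm

variable {X Y Z : Type u} [AddCommGroup X] [Module A X] [AddCommGroup Y] [Module A Y]
  [AddCommGroup Z] [Module A Z]

lemma Filtered.of_linearEquiv [Θ.IsClosedUnderIsomorphisms] (hX : Filtered Θ (ModuleCat.of A X))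
    (φ : X ≃ₗ[A] Y) : Filtered Θ (ModuleCat.of A Y) := by
  revert Y
  refine Filtered.induction (Θ := Θ) (P := fun M _ _ => ∀ {Y : Type u} [AddCommGroup Y]
    [Module A Y], (M ≃ₗ[A] Y) → Filtered Θ (ModuleCat.of A Y)) ?_ ?_ X hX
  · intro M _ _ hM Y _ _ φ
    have := φ.symm.toEquiv.subsingleton
    exact filtered_of_subsingleton Y
  · intro M _ _ N hN hΘ Y _ _ φ
    refine filtered_of_submodule (N := N.map φ.toLinearMap) (hN (φ.submoduleMap N)) ?_
    exact prop_of_linearEquiv (quotientEquiv φ fun x =>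
      (φ.injective.mem_set_image (s := N)).symm) hΘ

/-- `F(Θ)` is closed under extensions. -/
lemma Filtered.of_exact [Θ.IsClosedUnderIsomorphisms] {f : X →ₗ[A] Y} {g : Y →ₗ[A] Z}
    (hf : Function.Injective f) (hfg : Function.Exact f g) (hg : Function.Surjective g)
    (hX : Filtered Θ (ModuleCat.of A X)) (hZ : Filtered Θ (ModuleCat.of A Z)) :
    Filtered Θ (ModuleCat.of A Y) := by
  revert Y
  refine Filtered.induction (Θ := Θ) (P := fun M _ _ => ∀ {Y : Type u} [AddCommGroup Y]
    [Module A Y] {f : X →ₗ[A] Y} {g : Y →ₗ[A] M}, Function.Injective f → Function.Exact f g →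
    Function.Surjective g → Filtered Θ (ModuleCat.of A Y)) ?_ ?_ Z hZ
  · intro M _ _ hM Y _ _ f g hf hfg hg
    refine hX.of_linearEquiv (LinearEquiv.ofBijective f ⟨hf, fun y => (hfg y).1 ?_⟩)
    exact Subsingleton.elim _ _
  · intro M _ _ N hN hΘ Y _ _ f g hf hfg hg
    have hfN : ∀ x, f x ∈ N.comap g := fun x => by
      rw [Submodule.mem_comap, hfg.apply_apply_eq_zero]; exact N.zero_mem
    refine filtered_of_submodule (N := N.comap g) (hN (f := f.codRestrict _ hfN)
      (g := g.restrict fun y hy => hy) ?_ ?_ ?_) ?_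
    · exact fun x y h => hf (congrArg Subtype.val h)
    · rintro ⟨y, hy⟩
      refine ⟨fun h => ?_, ?_⟩
      · obtain ⟨x, hx⟩ := (hfg y).1 (congrArg Subtype.val h)
        exact ⟨x, Subtype.ext hx⟩
      · rintro ⟨x, hx⟩
        exact Subtype.ext ((hfg y).2 ⟨x, congrArg Subtype.val hx⟩)
    · rintro ⟨m, hm⟩
      obtain ⟨y, rfl⟩ := hg m
      exact ⟨⟨y, hm⟩, rfl⟩
    · refine prop_of_linearEquiv (LinearEquiv.trans (LinearMap.quotKerEquivOfSurjective
        (N.mkQ ∘ₗ g) (N.mkQ_surjective.comp hg)).symm (Submodule.quotEquivOfEq _ _ ?_)) hΘ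
      rw [LinearMap.ker_comp, Submodule.ker_mkQ]

lemma filtered_of_prop [Θ.IsClosedUnderIsomorphisms] (h : Θ (ModuleCat.of A X)) :
    Filtered Θ (ModuleCat.of A X) :=
  filtered_of_submodule (N := ⊥) (filtered_of_subsingleton _)
    (prop_of_linearEquiv (Submodule.quotEquivOfEqBot ⊥ rfl).symm h)

lemma filtered_pi [Θ.IsClosedUnderIsomorphisms] (h : Θ (ModuleCat.of A X)) (m : ℕ) :
    Filtered Θ (ModuleCat.of A (Fin m → X)) := by
  induction m with
  | zero => exact filtered_of_subsingleton _
  | succ m ih =>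
    have h1 : Filtered Θ (ModuleCat.of A (X × (Fin m → X))) :=
      Filtered.of_exact (f := LinearMap.inr A X (Fin m → X)) (g := LinearMap.fst A X (Fin m → X))
        LinearMap.inr_injective Function.Exact.inr_fst LinearMap.fst_surjective ih
        (filtered_of_prop h)
    exact h1.of_linearEquiv (Fin.consLinearEquiv A fun _ => X)

lemma Filtered.mono {Θ' : ObjectProperty (ModuleCat.{u} A)} (hΘ : Θ ≤ Θ') {M : ModuleCat.{u} A}
    (h : Filtered Θ M) : Filtered Θ' M := by
  obtain ⟨t, F, h0, ht, hF⟩ := h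
  exact ⟨t, F, h0, ht, fun i hi => ⟨(hF i hi).1, hΘ _ (hF i hi).2⟩⟩

lemma Filtered.extVanish_left [Θ.IsClosedUnderIsomorphisms] {k : ℕ}
    (h : ∀ (M : Type u) [AddCommGroup M] [Module A M], Θ (ModuleCat.of A M) → ExtVanish A k M Y)
    (hX : Filtered Θ (ModuleCat.of A X)) : ExtVanish A k X Y :=
  Filtered.induction (Θ := Θ) (P := fun M _ _ => ExtVanish A k M Y)
    (fun _ _ _ _ => extVanish_of_subsingleton_left)
    (fun _ _ _ N hN hΘ => ExtVanish.mid_left N.injective_subtype (exact_subtype_mkQ N)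
      N.mkQ_surjective hN (h _ hΘ)) X hX

lemma Filtered.extVanish_right [Θ.IsClosedUnderIsomorphisms] {k : ℕ}
    (h : ∀ (M : Type u) [AddCommGroup M] [Module A M], Θ (ModuleCat.of A M) → ExtVanish A k X M)
    (hY : Filtered Θ (ModuleCat.of A Y)) : ExtVanish A k X Y :=
  Filtered.induction (Θ := Θ) (P := fun M _ _ => ExtVanish A k X M)
    (fun _ _ _ _ => extVanish_of_subsingleton_right)
    (fun _ _ _ N hN hΘ => ExtVanish.mid_right N.injective_subtype (exact_subtype_mkQ N)
      N.mkQ_surjective hN (h _ hΘ)) Y hY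

end Filtrations

/-! ### Extensions of standard by costandard modules -/

section ExtStandardCostandard

variable {A : Type u} [Ring A] {n : ℕ} {e : Fin n → A}

variable (e) in
/-- The class of the standard modules `Δ(i)` with `i < k`, up to isomorphism. -/
def DeltaBelow (k : ℕ) : ObjectProperty (ModuleCat.{u} A) :=
  fun M => ∃ i : Fin n, (i : ℕ) < k ∧ Nonempty (M ≃ₗ[A] standard e i)

variable (e) in
/-- The class of the costandard modules `∇(i)` with `i < k`, up to isomorphism. -/
def NablaBelow (k : ℕ) : ObjectProperty (ModuleCat.{u} A) :=
  fun M => ∃ i : Fin n, (i : ℕ) < k ∧ Nonempty (M ≃ₗ[A] costandard e i)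

instance : (Delta e).IsClosedUnderIsomorphisms where
  of_iso φ := fun ⟨i, ⟨ψ⟩⟩ => ⟨i, ⟨φ.toLinearEquiv.symm.trans ψ⟩⟩

instance (k : ℕ) : (DeltaBelow e k).IsClosedUnderIsomorphisms where
  of_iso φ := fun ⟨i, hi, ⟨ψ⟩⟩ => ⟨i, hi, ⟨φ.toLinearEquiv.symm.trans ψ⟩⟩

instance (k : ℕ) : (NablaBelow e k).IsClosedUnderIsomorphisms where
  of_iso φ := fun ⟨i, hi, ⟨ψ⟩⟩ => ⟨i, hi, ⟨φ.toLinearEquiv.symm.trans ψ⟩⟩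

lemma deltaBelow_le (k : ℕ) : DeltaBelow e k ≤ Delta e := fun _ ⟨i, _, h⟩ => ⟨i, h⟩

lemma deltaBelow_mono {k l : ℕ} (h : k ≤ l) : DeltaBelow e k ≤ DeltaBelow e l :=
  fun _ ⟨i, hi, h'⟩ => ⟨i, hi.trans_le h, h'⟩

lemma nablaBelow_mono {k l : ℕ} (h : k ≤ l) : NablaBelow e k ≤ NablaBelow e l :=
  fun _ ⟨i, hi, h'⟩ => ⟨i, hi.trans_le h, h'⟩

lemma nablaBelow_le (k : ℕ) : NablaBelow e k ≤ Nabla e :=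
  fun _ ⟨i, _, h⟩ => ⟨i, envelope e i, envelopeEmb e i, isInjectiveEnvelope_envelopeEmb e i, h⟩

lemma IsQuasiHereditary.projective_P (hA : IsQuasiHereditary e) (i : Fin n) :
    Module.Projective A (P e i) := by
  refine Module.Projective.of_split (P e i).subtype
    (LinearMap.toSpanSingleton A (P e i) (spanGen (e i))) ?_
  ext x
  exact congrArg Subtype.val (eq_smul_spanGen (hA.idem i) x).symm

variable [IsArtinianRing A]

/-- `Δ(i)` is projective relative to the modules annihilated by the `e j`, `i < j`. -/
lemma IsQuasiHereditary.extVanish_standard_of_isBelow (hA : IsQuasiHereditary e) {i : Fin n}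
    {M : Type u} [AddCommGroup M] [Module A M] (hM : IsBelow e (i + 1) M) :
    ExtVanish A 1 (standard e i) M := by
  have := hA.projective_P i
  refine ExtVanish.thd_left (Submodule.injective_subtype _) (exact_subtype_mkQ _)
    (Submodule.mkQ_surjective _) ?_ extVanish_of_projective
  rw [hA.standardKernel_eq]
  exact extVanish_zero_iff.2 (hom_aboveSpan_eq_zero hA.complete hM)

lemma IsQuasiHereditary.extVanish_costandard_of_isBelow (hA : IsQuasiHereditary e) {i : Fin n}
    {M : Type u} [AddCommGroup M] [Module A M] (hM : IsBelow e (i + 1) M) :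
    ExtVanish A 1 M (costandard e i) := by
  refine ExtVanish.fst_right (Submodule.injective_subtype _) (exact_subtype_mkQ _)
    (Submodule.mkQ_surjective _) ?_
    (extVanish_of_injective (isInjectiveEnvelope_envelopeEmb e i).isInjective)
  refine extVanish_zero_iff.2 fun f => LinearMap.range_eq_bot.1 (le_bot_iff.1 ?_)
  have h : belowPart e (i + 1) (envelope e i ⧸ costandardIn e i (envelope e i)) = ⊥ := by
    rw [hA.costandardIn_eq]
    exact belowPart_quotient_belowPart hA.complete
  exact h ▸ hM.range_le f

lemma IsQuasiHereditary.extVanish_one_standard_costandard (hA : IsQuasiHereditary e)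
    (i j : Fin n) : ExtVanish A 1 (standard e i) (costandard e j) := by
  rcases le_total i j with h | h
  · exact hA.extVanish_costandard_of_isBelow
      ((hA.isBelow_standard i).mono (Nat.succ_le_succ h))
  · exact hA.extVanish_standard_of_isBelow
      ((hA.isBelow_costandard j).mono (Nat.succ_le_succ h))

lemma IsQuasiHereditary.extVanish_one_standard_standard (hA : IsQuasiHereditary e)
    {i j : Fin n} (h : j ≤ i) : ExtVanish A 1 (standard e i) (standard e j) :=
  hA.extVanish_standard_of_isBelow ((hA.isBelow_standard j).mono (Nat.succ_le_succ h))

/-- If `X` is filtered by standard modules, so is the submodule generated by the `e j • X` with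
`k ≤ j`. Adding a factor `Δ(a)` at the top of a filtration does not change this submodule
if `a < k`, and adds the factor `Δ(a)` to it if `k ≤ a`. -/
lemma IsQuasiHereditary.filtered_aboveSpan (hA : IsQuasiHereditary e) (k : ℕ) {X : Type u}
    [AddCommGroup X] [Module A X] (hX : Filtered (Delta e) (ModuleCat.of A X)) :
    Filtered (Delta e) (ModuleCat.of A (aboveSpan e k X)) := by
  refine Filtered.induction (Θ := Delta e)
    (P := fun M _ _ => Filtered (Delta e) (ModuleCat.of A (aboveSpan e k M))) ?_ ?_ X hX
  · intro M _ _ hM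
    exact filtered_of_subsingleton _
  rintro M _ _ N hN ⟨a, ⟨φ⟩⟩
  change (M ⧸ N) ≃ₗ[A] standard e a at φ
  have hle : ∀ x : aboveSpan e k N, ((x : N) : M) ∈ aboveSpan e k M := fun x =>
    map_aboveSpan_le N.subtype ⟨x, x.2, rfl⟩
  let f : aboveSpan e k N →ₗ[A] aboveSpan e k M :=
    (N.subtype ∘ₗ (aboveSpan e k N).subtype).codRestrict _ hle
  have hf : Function.Injective f := fun x y h =>
    Subtype.ext (Subtype.ext (congrArg (aboveSpan e k M).subtype h))
  let U : Submodule A M := (aboveSpan e k N).map N.subtype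
  have hU : ∀ j : Fin n, k ≤ j → ∀ x ∈ N, e j • x ∈ U := fun j hj x hx =>
    ⟨e j • ⟨x, hx⟩, smul_mem_aboveSpan hj _, rfl⟩
  rcases lt_or_ge (a : ℕ) k with hak | hka
  · have hB : IsBelow e k (M ⧸ N) :=
      ((hA.isBelow_standard a).mono hak).of_injective φ.toLinearMap φ.injective
    have hMN := isBelow_quotient_iff.1 hB
    have hMU : aboveSpan e k M ≤ U := by
      refine Submodule.span_le.2 ?_
      rintro _ ⟨j, hj, m, rfl⟩
      rw [← (hA.idem j).eq, mul_smul]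
      exact hU j hj _ (hMN (smul_mem_aboveSpan hj m))
    refine hN.of_linearEquiv (LinearEquiv.ofBijective f ⟨hf, ?_⟩)
    rintro ⟨x, hx⟩
    obtain ⟨y, hy, rfl⟩ := hMU hx
    exact ⟨⟨y, hy⟩, rfl⟩
  · let G : M →ₗ[A] standard e a := φ.toLinearMap ∘ₗ N.mkQ
    have hG : ∀ x, G x = 0 ↔ x ∈ N := fun x => by
      rw [LinearMap.comp_apply, LinearEquiv.coe_coe, LinearEquiv.map_eq_zero_iff,
        Submodule.mkQ_apply, Submodule.Quotient.mk_eq_zero]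
    obtain ⟨m₀, hm₀⟩ := (φ.surjective.comp N.mkQ_surjective) (standardGen e a)
    have hm : G (e a • m₀) = standardGen e a := by
      rw [map_smul]
      exact (congrArg _ hm₀).trans (hA.smul_standardGen a)
    -- a section of `M / U → Δ(a)`
    obtain ⟨s, hs⟩ := hA.exists_standard_hom (M := M ⧸ U) (i := a) (m := U.mkQ (e a • m₀))
      (by rw [← map_smul, smul_smul, (hA.idem a).eq]) (by
        intro j hj b
        have h1 : e j • b • e a • m₀ ∈ N := by
          rw [← hG, map_smul, map_smul, hm]
          exact hA.isBelow_standard a j hj _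
        have h2 := hU j (by lia) _ h1
        rw [smul_smul, (hA.idem j).eq] at h2
        rw [← map_smul, ← map_smul]
        exact (Submodule.Quotient.mk_eq_zero U).2 h2)
    have hsG : aboveSpan e k M ≤ LinearMap.eqLocus U.mkQ (s ∘ₗ G) := by
      refine Submodule.span_le.2 ?_
      rintro _ ⟨j, hj, m, rfl⟩
      obtain ⟨b, hb⟩ := hA.exists_smul_standardGen (G m)
      change U.mkQ (e j • m) = s (G (e j • m))
      have h1 : s (G (e j • m)) = U.mkQ (e j • b • e a • m₀) := by
        rw [map_smul G, hb, map_smul s, map_smul s, hs, ← map_smul, ← map_smul]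
      rw [h1, ← sub_eq_zero, ← map_sub, ← smul_sub]
      refine (Submodule.Quotient.mk_eq_zero U).2 (hU j hj _ ?_)
      rw [← hG, map_sub, map_smul, hm, hb, sub_self]
    refine Filtered.of_exact (f := f) (g := G ∘ₗ (aboveSpan e k M).subtype) hf ?_ ?_ hN
      (filtered_of_prop ⟨a, ⟨LinearEquiv.refl _ _⟩⟩)
    · rintro ⟨x, hx⟩
      refine ⟨fun h => ?_, ?_⟩
      · have h1 : U.mkQ x = s (G x) := hsG hx
        rw [show G x = 0 from h, map_zero] at h1
        obtain ⟨y, hy, rfl⟩ := (Submodule.Quotient.mk_eq_zero U).1 h1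
        exact ⟨⟨y, hy⟩, rfl⟩
      · rintro ⟨y, hy⟩
        rw [← hy]
        exact (hG _).2 (y : N).2
    · intro d
      obtain ⟨b, rfl⟩ := hA.exists_smul_standardGen d
      refine ⟨b • ⟨e a • m₀, smul_mem_aboveSpan hka m₀⟩, ?_⟩
      rw [map_smul]
      exact congrArg _ hm

/-- `Ext^k(Δ(i), ∇(j)) = 0` for `k > 0`. -/
theorem IsQuasiHereditary.extVanish_standard_costandard (hA : IsQuasiHereditary e) (k : ℕ)
    (i j : Fin n) : ExtVanish A (k + 1) (standard e i) (costandard e j) := by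
  induction k generalizing i with
  | zero => exact hA.extVanish_one_standard_costandard i j
  | succ k ih =>
    have := hA.projective_P i
    refine ExtVanish.thd_left (Submodule.injective_subtype _) (exact_subtype_mkQ _)
      (Submodule.mkQ_surjective _) ?_ extVanish_of_projective
    rw [hA.standardKernel_eq]
    -- the kernel of `P(i) → Δ(i)` is a direct summand of a module filtered by standard modules
    have h1 : ExtVanish A (k + 1) (aboveSpan e (i + 1) A) (costandard e j) := by
      refine Filtered.extVanish_left (Θ := Delta e) ?_ (hA.filtered_aboveSpan (i + 1) hA.filtered)
      rintro M _ _ ⟨i', ⟨φ⟩⟩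
      exact (ih i').congr_left φ
    let p : A →ₗ[A] P e i := LinearMap.toSpanSingleton A (P e i) (spanGen (e i))
    refine h1.of_retract_left
      ((P e i).subtype.restrict fun x hx => map_aboveSpan_le (P e i).subtype ⟨x, hx, rfl⟩)
      (p.restrict fun x hx => map_aboveSpan_le p ⟨x, hx, rfl⟩) ?_
    ext x
    exact congrArg Subtype.val (eq_smul_spanGen (hA.idem i) x).symm

end ExtStandardCostandard

/-! ### Costandard filtrations -/

section NablaFiltration

variable {A : Type u} [Ring A] {n : ℕ} {e : Fin n → A}

/-- A module that admits no nonzero homomorphism from any `Δ(j)` with `j < k` and is annihilated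
by the `e j`, `k ≤ j`, is zero: consider the largest `j` with `e j • Q ≠ 0`. -/
lemma subsingleton_of_standard_hom_eq_zero [IsArtinianRing A] (hA : IsQuasiHereditary e)
    {k : ℕ} {Q : Type*} [AddCommGroup Q] [Module A Q] (hQ : IsBelow e k Q)
    (h : ∀ j : Fin n, (j : ℕ) < k → ∀ f : standard e j →ₗ[A] Q, f = 0) : Subsingleton Q := by
  induction k with
  | zero => exact hQ.subsingleton hA.complete
  | succ k ih =>
    refine ih (fun j hj q => ?_) fun j hj => h j (by lia)
    rcases eq_or_ne (j : ℕ) k with hjk | hne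
    · obtain ⟨f, hf⟩ := hA.exists_standard_hom (i := j) (m := e j • q)
        (by rw [smul_smul, (hA.idem j).eq])
        (by
          rw [isBelow_iff_belowPart_eq_top.1 (show IsBelow e (j + 1) Q by rwa [hjk])]
          trivial)
      rw [← hf, h j (by lia) f, LinearMap.zero_apply]
    · exact hQ j (by lia) q

variable [IsArtinianRing A]

/-- The key step for recognizing costandard filtrations: a finitely generated module `Z` whose
composition factors are among the `E(j)`, `j ≤ i`, with socle a sum of copies of `E(i)`, and
with `Ext^1(Δ(j), Z) = 0` for `j < i`, is a direct sum of copies of `∇(i)`. -/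
theorem IsQuasiHereditary.exists_equiv_pi_costandard (hA : IsQuasiHereditary e) {i : Fin n}
    {Z : Type u} [AddCommGroup Z] [Module A Z] [Module.Finite A Z] (hZ : IsBelow e (i + 1) Z)
    (hZ' : belowPart e i Z = ⊥) (hext : ∀ j < i, ExtVanish A 1 (standard e j) Z) :
    ∃ m : ℕ, Nonempty (Z ≃ₗ[A] (Fin m → costandard e i)) := by
  obtain ⟨m, ⟨φ⟩⟩ := hA.exists_aboveSpan_equiv hZ hZ'
  -- the embedding of the socle of `Z` in the socle of `∇(i)^m` extends to `g : Z → ∇(i)^m`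
  let σ : aboveSpan e i Z →ₗ[A] (Fin m → costandard e i) :=
    LinearMap.pi fun l => hA.socleEmb i ∘ₗ LinearMap.proj l ∘ₗ φ.toLinearMap
  have hσ : Function.Injective σ := by
    intro x y h
    refine φ.injective (funext fun l => hA.injective_socleEmb i ?_)
    exact congrFun h l
  choose g hg using fun l => hA.exists_extend_costandard hZ (aboveSpan e i Z).subtype
    (Submodule.injective_subtype _) (LinearMap.proj l ∘ₗ σ)
  let G : Z →ₗ[A] (Fin m → costandard e i) := LinearMap.pi g
  have hG : ∀ x : aboveSpan e i Z, G x = σ x := fun x => funext fun l => hg l x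
  have hinj : Function.Injective G := by
    rw [← LinearMap.ker_eq_bot]
    by_contra hne
    obtain ⟨z, hz, hez, hz0⟩ := hA.exists_smul_ne_zero hZ hZ' hne
    have hzS : z ∈ aboveSpan e i Z := hez ▸ smul_mem_aboveSpan le_rfl z
    have h1 : σ ⟨z, hzS⟩ = σ 0 := by rw [← hG, map_zero]; exact hz
    exact hz0 (congrArg Subtype.val (hσ h1))
  -- the cokernel of `g` vanishes
  have hV : IsBelow e (i + 1) (Fin m → costandard e i) := fun j hj v =>
    funext fun l => hA.isBelow_costandard i j hj _
  have hsoc : ∀ v, e i • v ∈ LinearMap.range G := by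
    intro v
    choose w hw using fun l => hA.smul_costandard_mem (v l)
    refine ⟨φ.symm w, ?_⟩
    rw [hG]
    funext l
    change hA.socleEmb i (φ (φ.symm w) l) = _
    rw [φ.apply_symm_apply, hw]
    rfl
  have hQ : IsBelow e i ((Fin m → costandard e i) ⧸ LinearMap.range G) := by
    intro j hj x
    obtain ⟨v, rfl⟩ := Submodule.mkQ_surjective _ x
    rw [← map_smul, Submodule.mkQ_apply, Submodule.Quotient.mk_eq_zero]
    rcases eq_or_ne j i with rfl | hne
    · exact hsoc v
    · rw [hV j (by have := Fin.val_ne_of_ne hne; lia)]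
      exact Submodule.zero_mem _
  have hQ0 := subsingleton_of_standard_hom_eq_zero hA hQ fun j hj f => by
    obtain ⟨ψ, hψ⟩ := (hext j hj).exists_lift hinj (LinearMap.exact_map_mkQ_range G)
      (Submodule.mkQ_surjective _) f
    have h0 : ψ = 0 := by
      exact LinearMap.ext fun x => funext fun l => LinearMap.congr_fun
        (hA.standard_hom_costandard_eq_zero hj (LinearMap.proj l ∘ₗ ψ)) x
    rw [← hψ, h0, LinearMap.comp_zero]
  have hsurj : Function.Surjective G := by
    rw [← LinearMap.range_eq_top]
    exact Submodule.Quotient.subsingleton_iff.1 hQ0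
  exact ⟨m, ⟨LinearEquiv.ofBijective G ⟨hinj, hsurj⟩⟩⟩

lemma IsQuasiHereditary.extVanish_standard_of_filtered (hA : IsQuasiHereditary e) (k l : ℕ)
    (j : Fin n) {Y : Type u} [AddCommGroup Y] [Module A Y]
    (hY : Filtered (NablaBelow e l) (ModuleCat.of A Y)) :
    ExtVanish A (k + 1) (standard e j) Y := by
  refine Filtered.extVanish_right (Θ := NablaBelow e l) ?_ hY
  rintro M _ _ ⟨i, -, ⟨φ⟩⟩
  exact (hA.extVanish_standard_costandard k j i).congr_right φ

lemma IsQuasiHereditary.extVanish_belowPart (hA : IsQuasiHereditary e) {Y : Type u}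
    [AddCommGroup Y] [Module A Y] (k : ℕ) {j : Fin n} (hj : (j : ℕ) < k)
    (h : ExtVanish A 1 (standard e j) Y) : ExtVanish A 1 (standard e j) (belowPart e k Y) := by
  refine ExtVanish.fst_right (Submodule.injective_subtype _) (exact_subtype_mkQ _)
    (Submodule.mkQ_surjective _) (extVanish_zero_iff.2 fun f => ?_) h
  refine LinearMap.range_eq_bot.1 (le_bot_iff.1 ?_)
  rw [← belowPart_quotient_belowPart (k := k) hA.complete]
  exact ((hA.isBelow_standard j).mono hj).range_le f

/-- The successive quotients of the filtration of `Y` by the submodules `belowPart e k Y` are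
direct sums of costandard modules if `Ext^1(Δ(j), Y) = 0` for all `j`. -/
theorem IsQuasiHereditary.exists_belowPart_exact (hA : IsQuasiHereditary e) {Y : Type u}
    [AddCommGroup Y] [Module A Y] [Module.Finite A Y]
    (hY : ∀ j, ExtVanish A 1 (standard e j) Y) (i : Fin n)
    (hF : Filtered (NablaBelow e i) (ModuleCat.of A (belowPart e i Y))) :
    ∃ (m : ℕ) (g : belowPart e (i + 1) Y →ₗ[A] (Fin m → costandard e i)),
      Function.Exact (Submodule.inclusion (belowPart_mono (M := Y) (Nat.le_succ i))) g ∧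
        Function.Surjective g := by
  let ι := Submodule.inclusion (belowPart_mono (e := e) (M := Y) (Nat.le_succ i))
  have hι : Function.Injective ι := Submodule.inclusion_injective _
  have hex := LinearMap.exact_map_mkQ_range ι
  have hbot : belowPart e i (belowPart e (i + 1) Y ⧸ LinearMap.range ι) = ⊥ := by
    have h1 : LinearMap.range ι = belowPart e i (belowPart e (i + 1) Y) := by
      ext x
      refine ⟨?_, fun hx => ?_⟩
      · rintro ⟨y, rfl⟩
        exact fun j hj a => Subtype.ext (y.2 j hj a)
      · exact ⟨⟨x, map_mem_belowPart hx (Submodule.subtype _)⟩, rfl⟩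
    rw [h1]
    exact belowPart_quotient_belowPart hA.complete
  obtain ⟨m, ⟨φ⟩⟩ := hA.exists_equiv_pi_costandard (i := i)
    (isBelow_belowPart.quotient (LinearMap.range ι)) hbot fun j hj =>
      ExtVanish.thd_right hι hex (Submodule.mkQ_surjective _)
        (hA.extVanish_belowPart _ (by have : (j : ℕ) < i := hj; lia) (hY j))
        (hA.extVanish_standard_of_filtered 1 i j hF)
  refine ⟨m, φ.toLinearMap ∘ₗ (LinearMap.range ι).mkQ, fun x => ?_,
    φ.surjective.comp (Submodule.mkQ_surjective _)⟩
  rw [LinearMap.comp_apply, LinearEquiv.coe_coe, LinearEquiv.map_eq_zero_iff]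
  exact hex x

theorem IsQuasiHereditary.filtered_belowPart (hA : IsQuasiHereditary e) {Y : Type u}
    [AddCommGroup Y] [Module A Y] [Module.Finite A Y]
    (hY : ∀ j, ExtVanish A 1 (standard e j) Y) (k : ℕ) (hk : k ≤ n) :
    Filtered (NablaBelow e k) (ModuleCat.of A (belowPart e k Y)) := by
  induction k with
  | zero =>
    have := (isBelow_belowPart (e := e) (k := 0) (M := Y)).subsingleton hA.complete
    exact filtered_of_subsingleton _
  | succ k ih =>
    obtain ⟨m, g, hg, hg'⟩ := hA.exists_belowPart_exact hY ⟨k, hk⟩ (ih (by lia))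
    exact Filtered.of_exact (Submodule.inclusion_injective _) hg hg'
      ((ih (by lia)).mono (nablaBelow_mono (Nat.le_succ k)))
      (filtered_pi (Θ := NablaBelow e (k + 1)) ⟨⟨k, hk⟩, Nat.lt_succ_self k,
        ⟨LinearEquiv.refl _ _⟩⟩ m)

/-- A finitely generated module `Y` with `Ext^1(Δ(j), Y) = 0` for all `j` is filtered by
costandard modules. -/
theorem IsQuasiHereditary.filtered_of_extVanish (hA : IsQuasiHereditary e) {Y : Type u}
    [AddCommGroup Y] [Module A Y] [Module.Finite A Y]
    (hY : ∀ j, ExtVanish A 1 (standard e j) Y) :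
    Filtered (NablaBelow e n) (ModuleCat.of A Y) :=
  (hA.filtered_belowPart hY n le_rfl).of_linearEquiv
    (LinearEquiv.ofTop _ (isBelow_iff_belowPart_eq_top.1 (isBelow_of_le le_rfl)))

end NablaFiltration

/-! ### Universal extensions -/

section UniversalExtension

open Abelian

variable {A : Type u} [Ring A]

/-- Let `N'` be an extension of `Q` by `N` with `Ext^1(Z, Q) = 0`, and let `Y → Z` be an
epimorphism from a projective module with kernel `X`. Then `Ext^1(Z, N') = 0` if for all
homomorphisms `X → N` the composite `X → N → N'` extends to `Y`. -/
lemma extVanish_one_of_extension {X Y Z N N' Q : Type u} [AddCommGroup X] [Module A X]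
    [AddCommGroup Y] [Module A Y] [AddCommGroup Z] [Module A Z] [AddCommGroup N] [Module A N]
    [AddCommGroup N'] [Module A N'] [AddCommGroup Q] [Module A Q] [Module.Projective A Y]
    {f : X →ₗ[A] Y} {g : Y →ₗ[A] Z} (hf : Function.Injective f)
    (hfg : Function.Exact f g) (hg : Function.Surjective g)
    {i : N →ₗ[A] N'} {π : N' →ₗ[A] Q} (hi : Function.Injective i)
    (hiπ : Function.Exact i π) (hπ : Function.Surjective π) (hQ : ExtVanish A 1 Z Q)
    (h : ∀ φ : X →ₗ[A] N, ∃ ψ : Y →ₗ[A] N', ψ ∘ₗ f = i ∘ₗ φ) : ExtVanish A 1 Z N' := by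
  intro x
  obtain ⟨y, rfl⟩ := Ext.covariant_sequence_exact₂ _ (exists_shortExact hi hiπ hπ) x (hQ _)
  obtain ⟨z, rfl⟩ := Ext.contravariant_sequence_exact₃ (exists_shortExact hf hfg hg) _ y
    (extVanish_of_projective (k := 0) (X := Y) _) (add_zero 1)
  obtain ⟨φ, rfl⟩ := (Ext.mk₀_bijective _ _).2 z
  obtain ⟨ψ, hψ⟩ := h φ.hom
  have h1 : φ ≫ ModuleCat.ofHom i = ModuleCat.ofHom f ≫ ModuleCat.ofHom ψ :=
    ModuleCat.hom_ext hψ.symm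
  rw [Ext.comp_assoc_of_second_deg_zero]
  have h2 : (Ext.mk₀ φ).comp (Ext.mk₀ (ModuleCat.ofHom i)) (zero_add 0) =
      (Ext.mk₀ (ModuleCat.ofHom f)).comp (Ext.mk₀ (ModuleCat.ofHom ψ)) (zero_add 0) := by
    rw [Ext.mk₀_comp_mk₀, h1, Ext.mk₀_comp_mk₀]
  exact (congrArg (fun w => (exists_shortExact hf hfg hg).extClass.comp w (add_zero 1)) h2).trans
    ((exists_shortExact hf hfg hg).extClass_comp_assoc _)

/-- Over an Artin algebra, the homomorphisms between finitely generated modules form a finitely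
generated module over the base ring. -/
lemma exists_hom_generators (R : Type*) [CommRing R] [IsArtinianRing R] [Algebra R A]
    [Module.Finite R A]
    (K N : Type u) [AddCommGroup K] [Module A K] [AddCommGroup N]
    [Module A N] [Module.Finite A K] [Module.Finite A N] :
    ∃ (m : ℕ) (f : Fin m → (K →ₗ[A] N)), ∀ g : K →ₗ[A] N, ∃ r : Fin m → R,
      ∀ x, g x = ∑ l, f l (algebraMap R A (r l) • x) := by
  let _ : Module R N := Module.compHom N (algebraMap R A)
  have _ : IsScalarTower R A N := IsScalarTower.of_algebraMap_smul fun _ _ => rfl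
  have _ : Module.Finite R N := Module.Finite.trans A N
  have _ : SMulCommClass A R N := IsScalarTower.to_smulCommClass'
  obtain ⟨p, s, hs⟩ := Module.Finite.exists_fin (R := A) (M := K)
  let ev : (K →ₗ[A] N) →ₗ[R] (Fin p → N) :=
    { toFun g l := g (s l)
      map_add' _ _ := rfl
      map_smul' _ _ := rfl }
  have hev : Function.Injective ev := fun g g' h =>
    LinearMap.ext_on_range hs fun l => congrFun h l
  have _ : IsNoetherian R (K →ₗ[A] N) := isNoetherian_of_injective ev hev
  obtain ⟨m, f, hf⟩ := Module.Finite.exists_fin (R := R) (M := K →ₗ[A] N)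
  refine ⟨m, f, fun g => ?_⟩
  obtain ⟨r, rfl⟩ := (Submodule.mem_span_range_iff_exists_fun R).1
    (show g ∈ Submodule.span R (Set.range f) from hf ▸ Submodule.mem_top)
  refine ⟨r, fun x => ?_⟩
  simp only [LinearMap.sum_apply, map_smul]
  rfl

/-- The universal extension of `N` by `D = P / K`: if `Ext^1(D, D) = 0`, the module `N` is
contained in a module `N'` with `N' / N` a direct sum of copies of `D` and `Ext^1(D, N') = 0`.
It is the pushout of `K^m → P^m` along generators of `Hom(K, N)` over the base ring. -/
theorem exists_universal_extension (R : Type*) [CommRing R] [IsArtinianRing R] [Algebra R A]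
    [Module.Finite R A]
    (N : Type u) [AddCommGroup N] [Module A N]
    [Module.Finite A N] {P : Type u} [AddCommGroup P] [Module A P] [Module.Finite A P]
    [Module.Projective A P] (K : Submodule A P) [Module.Finite A K]
    (hD : ExtVanish A 1 (P ⧸ K) (P ⧸ K)) :
    ∃ (N' : ModuleCat.{u} A) (_ : Module.Finite A N') (m : ℕ) (i : N →ₗ[A] N')
      (π : N' →ₗ[A] (Fin m → P ⧸ K)), Function.Injective i ∧ Function.Exact i π ∧
        Function.Surjective π ∧ ExtVanish A 1 (P ⧸ K) N' := by
  obtain ⟨m, f, hf⟩ := exists_hom_generators (A := A) R K N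
  let c : (Fin m → K) →ₗ[A] N := LinearMap.lsum A (fun _ : Fin m => K) ℕ f
  have hc : ∀ x, c x = ∑ l, f l (x l) := fun x => by simp [c, LinearMap.lsum_apply]
  let ι : (Fin m → K) →ₗ[A] (Fin m → P) := LinearMap.pi fun l => K.subtype ∘ₗ LinearMap.proj l
  let θ : (Fin m → K) →ₗ[A] N × (Fin m → P) := c.prod (-ι)
  let i : N →ₗ[A] (N × (Fin m → P)) ⧸ LinearMap.range θ :=
    (LinearMap.range θ).mkQ ∘ₗ LinearMap.inl A N (Fin m → P)
  let π₀ : N × (Fin m → P) →ₗ[A] (Fin m → P ⧸ K) :=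
    LinearMap.pi fun l => K.mkQ ∘ₗ LinearMap.proj l ∘ₗ LinearMap.snd A N (Fin m → P)
  have hθ : LinearMap.range θ ≤ LinearMap.ker π₀ := by
    rintro _ ⟨x, rfl⟩
    refine funext fun l => (Submodule.Quotient.mk_eq_zero K).2 ?_
    exact K.neg_mem (x l).2
  let π := (LinearMap.range θ).liftQ π₀ hθ
  have hi : Function.Injective i := by
    rw [← LinearMap.ker_eq_bot]
    refine (Submodule.eq_bot_iff _).2 fun y hy => ?_
    obtain ⟨x, hx⟩ := (Submodule.Quotient.mk_eq_zero _).1 (show Submodule.Quotient.mk _ = _ from hy)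
    have hx0 : x = 0 := by
      funext l
      have := congrFun (congrArg Prod.snd hx) l
      exact Subtype.ext (neg_eq_zero.1 this)
    rw [hx0, map_zero] at hx
    exact (congrArg Prod.fst hx).symm
  have hiπ : Function.Exact i π := by
    intro z
    refine ⟨fun hz => ?_, ?_⟩
    · obtain ⟨⟨y, p⟩, rfl⟩ := Submodule.mkQ_surjective _ z
      have hp : ∀ l, p l ∈ K := fun l => (Submodule.Quotient.mk_eq_zero K).1 (congrFun hz l)
      refine ⟨y + c fun l => ⟨p l, hp l⟩, (Submodule.Quotient.eq _).2
        ⟨fun l => ⟨p l, hp l⟩, Prod.ext ?_ ?_⟩⟩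
      · change c _ = (y + c _) - y
        rw [add_sub_cancel_left]
      · change -(ι _) = 0 - p
        rw [zero_sub]
        rfl
    · rintro ⟨y, rfl⟩
      rfl
  have hπ : Function.Surjective π := by
    intro d
    choose p hp using fun l => K.mkQ_surjective (d l)
    exact ⟨Submodule.Quotient.mk (0, p), funext hp⟩
  refine ⟨ModuleCat.of A ((N × (Fin m → P)) ⧸ LinearMap.range θ),
    Module.Finite.quotient A (LinearMap.range θ), m, i, π, hi, hiπ, hπ, ?_⟩
  refine extVanish_one_of_extension K.injective_subtype (exact_subtype_mkQ K)
    K.mkQ_surjective hi hiπ hπ (hD.pi_right m) fun φ => ?_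
  obtain ⟨r, hr⟩ := hf φ
  let ψ : P →ₗ[A] (Fin m → P) :=
    { toFun p l := algebraMap R A (r l) • p
      map_add' p q := funext fun l => smul_add _ _ _
      map_smul' a p := funext fun l => by
        change algebraMap R A (r l) • a • p = a • algebraMap R A (r l) • p
        rw [smul_smul, smul_smul, Algebra.commutes] }
  refine ⟨(LinearMap.range θ).mkQ ∘ₗ LinearMap.inr A N (Fin m → P) ∘ₗ ψ, ?_⟩
  ext x
  have h : θ (fun l => algebraMap R A (r l) • x) = (φ x, 0) - (0, ψ x) := by
    refine Prod.ext ?_ ?_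
    · change c _ = φ x - 0
      rw [hc, hr, sub_zero]
    · change -(ι _) = 0 - ψ x
      rw [zero_sub]
      rfl
  exact ((Submodule.Quotient.eq (LinearMap.range θ)).2 ⟨_, h⟩).symm

end UniversalExtension

/-! ### Approximation by modules with costandard filtrations -/

section Approximation

variable {A : Type u} [Ring A] {n : ℕ} {e : Fin n → A} [IsArtinianRing A]

/-- Iterated universal extensions by `Δ(k - 1), …, Δ(0)`. -/
theorem IsQuasiHereditary.exists_approximation (R : Type*) [CommRing R]
    [IsArtinianRing R] [Algebra R A]
    [Module.Finite R A]
    (hA : IsQuasiHereditary e) (k : ℕ) (hk : k ≤ n)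
    (N : Type u) [AddCommGroup N] [Module A N] [Module.Finite A N]
    (hN : ∀ j : Fin n, k ≤ j → ExtVanish A 1 (standard e j) N) :
    ∃ (Y : ModuleCat.{u} A) (_ : Module.Finite A Y) (i : N →ₗ[A] Y), Function.Injective i ∧
      Filtered (DeltaBelow e k) (ModuleCat.of A (Y ⧸ LinearMap.range i)) ∧
        ∀ j, ExtVanish A 1 (standard e j) Y := by
  induction k generalizing N with
  | zero =>
    refine ⟨ModuleCat.of A N, ‹_›, LinearMap.id, Function.injective_id, ?_,
      fun j => hN j (Nat.zero_le _)⟩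
    have : Subsingleton (N ⧸ LinearMap.range (LinearMap.id : N →ₗ[A] N)) :=
      Submodule.Quotient.subsingleton_iff.2 LinearMap.range_id
    exact filtered_of_subsingleton _
  | succ k ih =>
    let κ : Fin n := ⟨k, hk⟩
    have := hA.projective_P κ
    obtain ⟨N₁, hN₁, m, i₁, π₁, hi₁, hex₁, hπ₁, hext₁⟩ := exists_universal_extension R N
      (standardKernel e κ) (hA.extVanish_one_standard_standard le_rfl)
    obtain ⟨Y, hY, i₂, hi₂, hF, hext⟩ := ih (by lia) N₁ (fun j hj => by
      rcases eq_or_ne j κ with rfl | hne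
      · exact hext₁
      · have hlt : k < j := lt_of_le_of_ne hj fun h => hne (Fin.ext h.symm)
        refine ExtVanish.mid_right hi₁ hex₁ hπ₁ (hN j hlt)
          (ExtVanish.pi_right (hA.extVanish_one_standard_standard ?_) m)
        exact Fin.le_def.2 hlt.le)
    refine ⟨Y, hY, i₂ ∘ₗ i₁, hi₂.comp hi₁, ?_, hext⟩
    let f : (N₁ ⧸ LinearMap.range i₁) →ₗ[A] (Y ⧸ LinearMap.range (i₂ ∘ₗ i₁)) :=
      (LinearMap.range i₁).mapQ _ i₂ (by rintro _ ⟨x, rfl⟩; exact ⟨x, rfl⟩)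
    let g : (Y ⧸ LinearMap.range (i₂ ∘ₗ i₁)) →ₗ[A] (Y ⧸ LinearMap.range i₂) :=
      Submodule.factor (LinearMap.range_comp_le_range i₁ i₂)
    refine Filtered.of_exact (f := f) (g := g) ?_ ?_ ?_ ?_
      (hF.mono (deltaBelow_mono (Nat.le_succ k)))
    · rw [← LinearMap.ker_eq_bot]
      refine (Submodule.eq_bot_iff _).2 fun x hx => ?_
      obtain ⟨y, rfl⟩ := Submodule.mkQ_surjective _ x
      obtain ⟨z, hz⟩ := (Submodule.Quotient.mk_eq_zero _).1
        (show Submodule.Quotient.mk (i₂ y) = _ from hx)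
      exact (Submodule.Quotient.mk_eq_zero _).2 ⟨z, hi₂ hz⟩
    · intro x
      obtain ⟨y, rfl⟩ := Submodule.mkQ_surjective _ x
      refine ⟨fun hx => ?_, ?_⟩
      · obtain ⟨z, hz⟩ := (Submodule.Quotient.mk_eq_zero _).1
          (show Submodule.Quotient.mk y = _ from hx)
        exact ⟨Submodule.Quotient.mk z, congrArg (Submodule.mkQ _) hz⟩
      · rintro ⟨z, hz⟩
        rw [← hz]
        obtain ⟨w, rfl⟩ := Submodule.mkQ_surjective _ z
        exact (Submodule.Quotient.mk_eq_zero _).2 ⟨w, rfl⟩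
    · exact Submodule.factor_surjective _
    · have h := filtered_pi (Θ := DeltaBelow e (k + 1)) (X := standard e κ)
        ⟨κ, Nat.lt_succ_self k, ⟨LinearEquiv.refl _ _⟩⟩ m
      refine h.of_linearEquiv ((LinearMap.quotKerEquivOfSurjective π₁ hπ₁).symm.trans
        (Submodule.quotEquivOfEq _ _ ?_))
      exact LinearMap.exact_iff.1 hex₁

end Approximation

/-! ### Dimensions and finitely generated modules -/

section Dimensions

open Abelian

variable {A : Type u} [Ring A]

lemma ExtVanish.exists_extend {X Y Z W : Type u} [AddCommGroup X] [Module A X]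
    [AddCommGroup Y] [Module A Y] [AddCommGroup Z] [Module A Z] [AddCommGroup W] [Module A W]
    {f : X →ₗ[A] Y} {g : Y →ₗ[A] Z} (hf : Function.Injective f) (hfg : Function.Exact f g)
    (hg : Function.Surjective g) (h : ExtVanish A 1 Z W) (φ : X →ₗ[A] W) :
    ∃ ψ : Y →ₗ[A] W, ψ ∘ₗ f = φ := by
  obtain ⟨y, hy⟩ := Ext.contravariant_sequence_exact₁ (exists_shortExact hf hfg hg)
    (ModuleCat.of A W) (Ext.mk₀ (ModuleCat.ofHom φ)) rfl (h _)
  obtain ⟨ψ, rfl⟩ := (Ext.mk₀_bijective _ _).2 y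
  rw [Ext.mk₀_comp_mk₀] at hy
  exact ⟨ψ.hom, congrArg ModuleCat.Hom.hom ((Ext.mk₀_bijective _ _).1 hy)⟩

lemma hasProjectiveDimensionLE_iff_extVanish {M : ModuleCat.{u} A} {d : ℕ} :
    HasProjectiveDimensionLE M d ↔ ∀ k > d, ∀ (W : Type u) [AddCommGroup W] [Module A W],
      ExtVanish A k M W := by
  rw [HasProjectiveDimensionLE, hasProjectiveDimensionLT_iff.{u}]
  exact ⟨fun h k hk W _ _ x => h k hk x, fun h k hk W x => h k hk W x⟩

lemma hasInjectiveDimensionLE_iff_extVanish {M : ModuleCat.{u} A} {d : ℕ} :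
    HasInjectiveDimensionLE M d ↔ ∀ k > d, ∀ (W : Type u) [AddCommGroup W] [Module A W],
      ExtVanish A k W M := by
  rw [HasInjectiveDimensionLE, hasInjectiveDimensionLT_iff.{u}]
  exact ⟨fun h k hk W _ _ x => h k hk x, fun h k hk W x => h k hk W x⟩

/-- Over a Noetherian ring, the projective dimension of a finitely generated module is determined
by its extensions by finitely generated modules. -/
theorem extVanish_of_finite_right [IsNoetherianRing A] {d : ℕ} {M : Type u} [AddCommGroup M]
    [Module A M] [Module.Finite A M]
    (h : ∀ k > d, ∀ (N : Type u) [AddCommGroup N] [Module A N], Module.Finite A N →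
      ExtVanish A k M N)
    {k : ℕ} (hk : d < k) (W : Type u) [AddCommGroup W] [Module A W] : ExtVanish A k M W := by
  induction d generalizing M k with
  | zero =>
    obtain ⟨p, f, hf⟩ := Module.Finite.exists_fin' A M
    obtain ⟨s, hs⟩ := (h 1 one_pos (LinearMap.ker f) inferInstance).exists_lift
      (Submodule.injective_subtype _) (LinearMap.exact_subtype_ker_map f) hf LinearMap.id
    have : Module.Projective A M := Module.Projective.of_split s f hs
    obtain ⟨k, rfl⟩ := Nat.exists_eq_add_one_of_ne_zero hk.ne'
    exact extVanish_of_projective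
  | succ d ih =>
    obtain ⟨p, f, hf⟩ := Module.Finite.exists_fin' A M
    obtain ⟨k, rfl⟩ := Nat.exists_eq_add_one_of_ne_zero (by lia : k ≠ 0)
    obtain ⟨k, rfl⟩ := Nat.exists_eq_add_one_of_ne_zero (by lia : k ≠ 0)
    refine ExtVanish.thd_left (Submodule.injective_subtype _) (LinearMap.exact_subtype_ker_map f) hf
      (ih (M := LinearMap.ker f) (fun l hl N _ _ hN => ?_) (by lia)) extVanish_of_projective
    obtain ⟨l, rfl⟩ := Nat.exists_eq_add_one_of_ne_zero (by lia : l ≠ 0)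
    exact ExtVanish.fst_left (Submodule.injective_subtype _) (LinearMap.exact_subtype_ker_map f) hf
      extVanish_of_projective (h _ (by lia) N hN)

/-- By Baer's criterion, the injective dimension of a module is determined by its extensions
of finitely generated modules. -/
theorem extVanish_of_finite_left {d : ℕ} {N : Type u} [AddCommGroup N] [Module A N]
    (h : ∀ k > d, ∀ (M : Type u) [AddCommGroup M] [Module A M], Module.Finite A M →
      ExtVanish A k M N)
    {k : ℕ} (hk : d < k) (W : Type u) [AddCommGroup W] [Module A W] : ExtVanish A k W N := by
  induction d generalizing N k with
  | zero =>
    have hN : Module.Baer A N := fun I g => by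
      obtain ⟨ψ, hψ⟩ := (h 1 one_pos (A ⧸ I) inferInstance).exists_extend
        (Submodule.injective_subtype I) (exact_subtype_mkQ I) (Submodule.mkQ_surjective I) g
      exact ⟨ψ, fun x hx => LinearMap.congr_fun hψ ⟨x, hx⟩⟩
    obtain ⟨k, rfl⟩ := Nat.exists_eq_add_one_of_ne_zero hk.ne'
    exact extVanish_of_injective hN.injective
  | succ d ih =>
    obtain ⟨⟨I, hI, f, hf⟩⟩ := EnoughInjectives.presentation (ModuleCat.of A N)
    have hI : Module.Injective A I := Module.injective_module_of_injective_object A I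
    replace hf : Function.Injective f.hom := (ModuleCat.mono_iff_injective f).1 hf
    have hex := LinearMap.exact_map_mkQ_range f.hom
    obtain ⟨k, rfl⟩ := Nat.exists_eq_add_one_of_ne_zero (by lia : k ≠ 0)
    obtain ⟨k, rfl⟩ := Nat.exists_eq_add_one_of_ne_zero (by lia : k ≠ 0)
    refine ExtVanish.fst_right hf hex (Submodule.mkQ_surjective _)
      (ih (fun l hl M _ _ hM => ?_) (by lia)) (extVanish_of_injective hI)
    obtain ⟨l, rfl⟩ := Nat.exists_eq_add_one_of_ne_zero (by lia : l ≠ 0)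
    exact ExtVanish.thd_right hf hex (Submodule.mkQ_surjective _) (extVanish_of_injective hI)
      (h _ (by lia) M hM)

end Dimensions

/-! ### Bounds in terms of the characteristic module -/

section CharacteristicModule

variable {A : Type u} [Ring A] {n : ℕ} {e : Fin n → A}

lemma isBelow_of_filtered [IsArtinianRing A] (hA : IsQuasiHereditary e) {k : ℕ} {M : Type u}
    [AddCommGroup M] [Module A M] (hM : Filtered (DeltaBelow e k) (ModuleCat.of A M)) :
    IsBelow e k M := by
  refine Filtered.induction (Θ := DeltaBelow e k) (P := fun M _ _ => IsBelow e k M) ?_ ?_ M hM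
  · exact fun M _ _ hM j hj m => Subsingleton.elim _ _
  · rintro M _ _ N hN ⟨i, hi, ⟨φ⟩⟩
    exact IsBelow.of_exact hA.complete (exact_subtype_mkQ N) hN
      (((hA.isBelow_standard i).mono hi).of_injective φ.toLinearMap φ.injective)

variable [IsArtinianRing A]

/-- For each `i`, iterated universal extensions of `Δ(i)` by the `Δ(j)` with `j < i` lead to
a module in `F(Δ) ∩ F(∇) = add T` that contains `Δ(i)`. -/
theorem IsCharacteristicModule.exists_summand
    (R : Type*) [CommRing R] [IsArtinianRing R] [Algebra R A] [Module.Finite R A]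
    (hA : IsQuasiHereditary e) {T : ModuleCat.{u} A} (hT : IsCharacteristicModule e T)
    (i : Fin n) :
    ∃ (Y : ModuleCat.{u} A) (_ : Module.Finite A Y) (f : standard e i →ₗ[A] Y),
      Function.Injective f ∧
      Filtered (DeltaBelow e i) (ModuleCat.of A (Y ⧸ LinearMap.range f)) ∧
      (∀ j, ExtVanish A 1 (standard e j) Y) ∧ addClosure T Y := by
  obtain ⟨Y, hY, f, hf, hF, hext⟩ := hA.exists_approximation R i i.2.le (standard e i)
    (fun j hj => hA.extVanish_one_standard_standard (Fin.le_def.2 hj))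
  refine ⟨Y, hY, f, hf, hF, hext, (hT.add_iff Y hY).2 ⟨?_, ?_⟩⟩
  · exact Filtered.of_exact (Θ := Delta e) hf (LinearMap.exact_map_mkQ_range f)
      (Submodule.mkQ_surjective _) (filtered_of_prop ⟨i, ⟨LinearEquiv.refl _ _⟩⟩)
      (hF.mono (deltaBelow_le i))
  · exact Filtered.mono (nablaBelow_le n) (hA.filtered_of_extVanish hext)

/-- The projective dimension of the standard modules is at most that of `T`. -/
theorem IsCharacteristicModule.extVanish_standard
    (R : Type*) [CommRing R] [IsArtinianRing R] [Algebra R A] [Module.Finite R A]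
    (hA : IsQuasiHereditary e) {T : ModuleCat.{u} A} (hT : IsCharacteristicModule e T)
    {t : ℕ} {W : Type u} [AddCommGroup W] [Module A W] (h : ∀ k > t, ExtVanish A k T W)
    (i : Fin n) : ∀ k > t, ExtVanish A k (standard e i) W := by
  induction i using WellFoundedLT.induction with
  | ind i ih =>
  intro k hk
  obtain ⟨Y, -, f, hf, hF, -, m, s, r, hrs⟩ := hT.exists_summand R hA i
  refine ExtVanish.fst_left hf (LinearMap.exact_map_mkQ_range f) (Submodule.mkQ_surjective _)
    (((h k hk).pi_left m).of_retract_left s r hrs) ?_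
  refine Filtered.extVanish_left (Θ := DeltaBelow e i) ?_ hF
  rintro M _ _ ⟨j, hj, ⟨φ⟩⟩
  exact (ih j hj (k + 1) (by lia)).congr_left φ

/-- The injective dimension of the costandard modules is at most that of `T`. -/
theorem IsCharacteristicModule.extVanish_costandard
    (R : Type*) [CommRing R] [IsArtinianRing R] [Algebra R A] [Module.Finite R A]
    (hA : IsQuasiHereditary e) {T : ModuleCat.{u} A} (hT : IsCharacteristicModule e T)
    {s : ℕ} {W : Type u} [AddCommGroup W] [Module A W] (h : ∀ k > s, ExtVanish A k W T)
    (i : Fin n) : ∀ k > s, ExtVanish A k W (costandard e i) := by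
  induction i using WellFoundedLT.induction with
  | ind i ih =>
  intro k hk
  obtain ⟨Y, hY, f, hf, hF, hext, p, ι, r, hrι⟩ := hT.exists_summand R hA i
  have hB : IsBelow e (i + 1) Y := IsBelow.of_exact hA.complete
    (LinearMap.exact_map_mkQ_range f) (hA.isBelow_standard i)
    ((isBelow_of_filtered hA hF).mono (Nat.le_succ _))
  have hF' := hA.filtered_belowPart hext i i.2.le
  obtain ⟨m, g, hg, hg'⟩ := hA.exists_belowPart_exact hext i hF'
  -- `m ≠ 0` as `e i` does not annihilate `Δ(i) ⊆ Y`
  have hm : 0 < m := by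
    refine Nat.pos_of_ne_zero fun hm0 => ?_
    subst hm0
    have h1 : f (standardGen e i) ∈ belowPart e (i + 1) Y := by
      rw [isBelow_iff_belowPart_eq_top.1 hB]; trivial
    obtain ⟨y, hy⟩ := (hg ⟨_, h1⟩).1 (Subsingleton.elim _ _)
    have h2 : (y : Y) = f (standardGen e i) := congrArg Subtype.val hy
    have h3 := y.2 i le_rfl 1
    rw [h2, one_smul, ← map_smul, hA.smul_standardGen] at h3
    exact hA.standardGen_ne_zero i (hf (h3.trans (map_zero f).symm))
  have hV : ExtVanish A k W (Fin m → costandard e i) := by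
    refine ExtVanish.thd_right (Submodule.inclusion_injective _) hg hg' ?_ ?_
    · exact ExtVanish.congr_right (((h k hk).pi_right p).of_retract_right ι r hrι)
        (LinearEquiv.ofTop _ (isBelow_iff_belowPart_eq_top.1 hB))
    · refine Filtered.extVanish_right (Θ := NablaBelow e i) ?_ hF'
      rintro M _ _ ⟨j, hj, ⟨φ⟩⟩
      exact (ih j hj (k + 1) (by lia)).congr_right φ
  exact hV.of_retract_right (LinearMap.single A (fun _ : Fin m => costandard e i) ⟨0, hm⟩)
    (LinearMap.proj ⟨0, hm⟩) (LinearMap.proj_comp_single_same _ _ _)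

/-- If `Ext^k(Δ(j), N) = 0` for `k > r`, the module `N` has a coresolution of length `r` by
modules filtered by costandard modules. Hence its injective dimension exceeds that of the
costandard modules by at most `r`. -/
theorem IsQuasiHereditary.extVanish_of_costandard
    (R : Type*) [CommRing R] [IsArtinianRing R] [Algebra R A] [Module.Finite R A]
    (hA : IsQuasiHereditary e) {s : ℕ} {W : Type u} [AddCommGroup W] [Module A W]
    (hs : ∀ (i : Fin n), ∀ k > s, ExtVanish A k W (costandard e i)) (r : ℕ)
    {N : Type u} [AddCommGroup N] [Module A N] [Module.Finite A N]
    (hN : ∀ k > r, ∀ j, ExtVanish A k (standard e j) N) : ∀ k > s + r, ExtVanish A k W N := by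
  have hfil : ∀ k > s, ∀ (Y : Type u) [AddCommGroup Y] [Module A Y],
      Filtered (NablaBelow e n) (ModuleCat.of A Y) → ExtVanish A k W Y := by
    intro k hk Y _ _ hY
    refine Filtered.extVanish_right (Θ := NablaBelow e n) ?_ hY
    rintro M _ _ ⟨i, -, ⟨φ⟩⟩
    exact (hs i k hk).congr_right φ
  induction r generalizing N with
  | zero => exact fun k hk => hfil k hk N (hA.filtered_of_extVanish (hN 1 one_pos))
  | succ r ih =>
    intro k hk
    obtain ⟨k, rfl⟩ := Nat.exists_eq_add_one_of_ne_zero (by lia : k ≠ 0)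
    obtain ⟨Y, hY, i, hi, -, hext⟩ := hA.exists_approximation R n le_rfl N
      (fun j hj => absurd j.2 (by lia))
    have hYF := hA.filtered_of_extVanish hext
    have hex := LinearMap.exact_map_mkQ_range i
    refine ExtVanish.fst_right hi hex (Submodule.mkQ_surjective _)
      (ih (fun l hl j => ?_) k (by lia)) (hfil _ (by lia) Y hYF)
    obtain ⟨l, rfl⟩ := Nat.exists_eq_add_one_of_ne_zero (by lia : l ≠ 0)
    exact ExtVanish.thd_right hi hex (Submodule.mkQ_surjective _)
      (hA.extVanish_standard_of_filtered l n j hYF) (hN _ (by lia) j)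

/-- The upper bound for the projective dimensions of the finitely generated modules. -/
theorem IsCharacteristicModule.hasProjectiveDimensionLE
    (R : Type*) [CommRing R] [IsArtinianRing R] [Algebra R A] [Module.Finite R A]
    (hA : IsQuasiHereditary e) {T : ModuleCat.{u} A} (hT : IsCharacteristicModule e T)
    {t s : ℕ} (ht : HasProjectiveDimensionLE T t) (hs : HasInjectiveDimensionLE T s)
    (M : ModuleCat.{u} A) [Module.Finite A M] : HasProjectiveDimensionLE M (t + s) := by
  rw [hasProjectiveDimensionLE_iff_extVanish] at ht ⊢
  rw [hasInjectiveDimensionLE_iff_extVanish] at hs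
  intro k hk W _ _
  refine extVanish_of_finite_right (fun l hl N _ _ hN => ?_) hk W
  exact hA.extVanish_of_costandard R
    (fun i => hT.extVanish_costandard R hA (fun k hk => hs k hk M) i) t
    (fun k hk j => hT.extVanish_standard R hA (fun k hk => ht k hk N) j k hk) l (by lia)

/-- The characteristic module of a nonzero algebra is nonzero, because `Δ(i)` embeds in some
module in `add T`. -/
lemma IsCharacteristicModule.nontrivial
    (R : Type*) [CommRing R] [IsArtinianRing R] [Algebra R A] [Module.Finite R A] [Nontrivial A]
    (hA : IsQuasiHereditary e) {T : ModuleCat.{u} A} (hT : IsCharacteristicModule e T) :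
    Nontrivial T := by
  by_contra hT0
  rw [not_nontrivial_iff_subsingleton] at hT0
  obtain ⟨i⟩ : Nonempty (Fin n) := by
    by_contra hn
    rw [not_nonempty_iff] at hn
    refine one_ne_zero (α := A) ?_
    rw [← hA.complete.complete, Finset.univ_eq_empty, Finset.sum_empty]
  obtain ⟨Y, -, f, hf, -, -, m, s, r, hrs⟩ := hT.exists_summand R hA i
  refine hA.standardGen_ne_zero i (hf ?_)
  rw [← LinearMap.id_apply (R := A) (f (standardGen e i)), ← hrs, LinearMap.comp_apply,
    Subsingleton.elim (s _) 0, map_zero, map_zero]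

end CharacteristicModule

/-! ### The global dimension -/

section GlobalDimension

variable {A : Type u} [Ring A]

lemma projectiveDimension_le_globalDimension (M : ModuleCat.{u} A) (hM : Module.Finite A M) :
    projectiveDimension M ≤ globalDimension A :=
  le_iSup₂ (f := fun (M : ModuleCat.{u} A) (_ : Module.Finite A M) => projectiveDimension M) M hM

lemma eq_bot_or_eq_top_or_exists_nat (x : WithBot ℕ∞) : x = ⊥ ∨ x = ⊤ ∨ ∃ d : ℕ, x = d := by
  induction x with
  | bot => exact Or.inl rfl
  | coe x =>
    induction x with
    | top => exact Or.inr (Or.inl rfl)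
    | coe d => exact Or.inr (Or.inr ⟨d, rfl⟩)

lemma top_add_of_ne_bot {x : WithBot ℕ∞} (hx : x ≠ ⊥) : ⊤ + x = ⊤ := by
  induction x with
  | bot => exact absurd rfl hx
  | coe x => exact congrArg WithBot.some (top_add x)

/-- The injective dimension of any module is at most the global dimension, for which only
finitely generated modules count. -/
lemma injectiveDimension_le_globalDimension (h : globalDimension A ≠ ⊥) (N : ModuleCat.{u} A) :
    injectiveDimension N ≤ globalDimension A := by
  rcases eq_bot_or_eq_top_or_exists_nat (globalDimension A) with h0 | h0 | ⟨d, hd⟩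
  · exact absurd h0 h
  · rw [h0]; exact le_top
  rw [hd, injectiveDimension_le_iff, hasInjectiveDimensionLE_iff_extVanish]
  intro k hk W _ _
  refine extVanish_of_finite_left (fun l hl M _ _ hM => ?_) hk W
  have hM' := projectiveDimension_le_globalDimension (ModuleCat.of A M) hM
  rw [hd, projectiveDimension_le_iff, hasProjectiveDimensionLE_iff_extVanish] at hM'
  exact hM' l hl N

end GlobalDimension

end QuasiHereditary

theorem corollary2p10 {R : Type*} [CommRing R] [IsArtinianRing R]
    {A : Type u} [Ring A] [Algebra R A] [Module.Finite R A]
    {n : ℕ} (e : Fin n → A) (hA : QuasiHereditary.IsQuasiHereditary e)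
    (T : ModuleCat.{u} A) (hT : QuasiHereditary.IsCharacteristicModule e T) :
    max (projectiveDimension T) (injectiveDimension T) ≤ QuasiHereditary.globalDimension A ∧
      QuasiHereditary.globalDimension A ≤ projectiveDimension T + injectiveDimension T := by
  have : IsArtinianRing A := isArtinian_of_tower R inferInstance
  have hpd := QuasiHereditary.projectiveDimension_le_globalDimension T hT.finite
  rcases subsingleton_or_nontrivial A with hA0 | hA0
  · have hzero : ∀ M : ModuleCat.{u} A, Limits.IsZero M := fun M => by
      have := Module.subsingleton A M
      exact ModuleCat.isZero_of_subsingleton M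
    have hgl : QuasiHereditary.globalDimension A = ⊥ :=
      le_bot_iff.1 (iSup₂_le fun M _ => ((projectiveDimension_eq_bot_iff M).2 (hzero M)).le)
    rw [hgl, (projectiveDimension_eq_bot_iff T).2 (hzero T),
      (injectiveDimension_eq_bot_iff T).2 (hzero T)]
    simp
  · have hT0 : ¬ Limits.IsZero T := by
      rw [ModuleCat.isZero_iff_subsingleton, not_subsingleton_iff_nontrivial]
      exact hT.nontrivial R hA
    have hp : projectiveDimension T ≠ ⊥ := mt (projectiveDimension_eq_bot_iff T).1 hT0
    have hi : injectiveDimension T ≠ ⊥ := mt (injectiveDimension_eq_bot_iff T).1 hT0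
    refine ⟨max_le hpd (QuasiHereditary.injectiveDimension_le_globalDimension
      (fun h => hp (le_bot_iff.1 (h ▸ hpd))) T), iSup₂_le fun M hM => ?_⟩
    rcases QuasiHereditary.eq_bot_or_eq_top_or_exists_nat (projectiveDimension T)
      with h | h | ⟨t, ht⟩
    · exact absurd h hp
    · rw [h, QuasiHereditary.top_add_of_ne_bot hi]
      exact le_top
    rcases QuasiHereditary.eq_bot_or_eq_top_or_exists_nat (injectiveDimension T)
      with h | h | ⟨s, hs⟩
    · exact absurd h hi
    · rw [h, add_comm, QuasiHereditary.top_add_of_ne_bot hp]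
      exact le_top
    rw [ht, hs, ← Nat.cast_add, projectiveDimension_le_iff]
    exact hT.hasProjectiveDimensionLE R hA ((projectiveDimension_le_iff T t).1 ht.le)
      ((injectiveDimension_le_iff T s).1 hs.le) M
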